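/- Consider a Markov decision process with finite state set $\mathcal S$, finite or infinite action set $\mathcal A$, transition probabilities $P(s'|s,a)$, real rewards $r(s,a,s')$, and discount factor $\gamma\in[0,1)$; let $\lambda\in[0,1]$. Policies are densities with respect to a fixed $\sigma$-finite reference measure on $\mathcal A$ (counting measure for discrete actions). Let $\pi_b$ be a fixed behavior policy with $\pi_b(a|s)>0$ for all $s,a$, and let $\pi_w$, $w\in\mathbb R^K$, be a family of positive target policies, differentiable in $w$, under which the rewards have finite expectation and such that $\|\nabla\pi_w(a|s)\|\,\bigl(1+\sum_{s'}P(s'|s,a)|r(s,a,s')|\bigr)$ is, locally in $w$, dominated by an integrable function of $a$ (where $\nabla$ is the gradient in $w$). Let $(s_t,a_t)_{t\ge0}$ be a trajectory generated by $\pi_b$, with $r_{t+1}=r(s_t,a_t,s_{t+1})$, and let $d(s)=\lim_{t\to\infty}\Pr(s_t=s)$ be its stationary state distribution (the limits are assumed to exist). Let $\phi(s)\in\mathbb R^n$ be feature vectors such that some $u\in\mathbb R^n$ satisfies $u^\top\phi(s)=1$ for all $s$ (for instance, the last feature is identically $1$, or the features are tabular). Put $$\rho_t=\frac{\pi_w(a_t|s_t)}{\pi_b(a_t|s_t)},\qquad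 \phi_t=\phi(s_t),\qquad \delta_t=r_{t+1}+\gamma\theta^\top\phi_{t+1}-\theta^\top\phi_t .$$ For every $w$ let $\theta=\theta(w)$ be an Emphatic-TD($\lambda$) solution, that is, $\lim_{t\to\infty}\mathbb E[\rho_t\delta_te_t]=0$, where $$e_t=m_t\phi_t+\gamma\lambda\rho_{t-1}e_{t-1},\qquad m_t=1+\gamma\rho_{t-1}(m_{t-1}-\lambda),\qquad e_{-1}=0,\ m_{-1}=\lambda,$$ and let $J(w)=\sum_s d(s)\,\theta(w)^\top\phi(s)$. Then, for every $w$ (on-policy, $\pi_w=\pi_b$, or off-policy) and every $\lambda\in[0,1]$, $J$ is differentiable at $w$, the expectations below exist, and $$\nabla J(w)=\lim_{t\to\infty}\mathbb E[\rho_t\delta_t\psi_t],$$ where $$\psi_t=f^\lambda_t\,\nabla\log\pi_w(a_t|s_t)+z_t+\gamma\lambda\rho_{t-1}\psi_{t-1},\qquad f^\lambda_t=m_t+\gamma\lambda\rho_{t-1}f^\lambda_{t-1},$$ $$z_t=\gamma\rho_{t-1}\bigl((m_{t-1}-\lambda)\nabla\log\pi_w(a_{t-1}|s_{t-1})+z_{t-1}\bigr),\qquad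 \psi_{-1}=0,\ f^\lambda_{-1}=0,\ z_{-1}=0 .$$ -/

import Mathlib

open MeasureTheory Filter Topology

noncomputable section

namespace EmphaticAC

/-- A Markov decision process with finite state set `S` and (finite or infinite, discrete or
continuous) measurable action set `A`: transition probabilities `P s a s' = P(s' | s, a)` and
rewards `r s a s'` for taking `a` in `s` and arriving at `s'`. -/
structure MDP (S A : Type*) [Fintype S] [MeasurableSpace A] where
  P : S → A → S → ℝ
  r : S → A → S → ℝ
  P_nonneg : ∀ s a s', 0 ≤ P s a s'
  P_sum : ∀ s a, ∑ s', P s a s' = 1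
  P_meas : ∀ s s', Measurable fun a => P s a s'
  r_meas : ∀ s s', Measurable fun a => r s a s'

variable {S A Ω : Type*}

/-- `p s a = p(a | s)` is a stationary policy, given as a probability density with respect to the
reference measure `ν` on actions (the counting measure for discrete actions, Lebesgue measure for
continuous ones). -/
structure IsPolicy [MeasurableSpace A] (ν : Measure A) (p : S → A → ℝ) : Prop where
  meas : ∀ s, Measurable (p s)
  nonneg : ∀ s a, 0 ≤ p s a
  integral_eq_one : ∀ s, ∫ a, p s a ∂ν = 1

/-- The size `1 + E[|r_{t+1}| | s_t = s, a_t = a]` of the rewards. -/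
def MDP.rewardSize [Fintype S] [MeasurableSpace A] (M : MDP S A) (s : S) (a : A) : ℝ :=
  1 + ∑ s', M.P s a s' * |M.r s a s'|

/-- A parametrized family of policies `π_w`, `w ∈ ℝ^K`, positive and differentiable in `w`, under
which rewards have finite expectation, and for which `∇π_w` (weighted by the size of the rewards)
is, locally in `w`, dominated by an integrable function of the action. The domination is implied
by finite expected rewards together with a bounded score `∇ log π_w(a|s)`, and, when there are
finitely many actions, by continuous differentiability. -/
structure IsPolicyFamily [Fintype S] [MeasurableSpace A] {K : ℕ} (M : MDP S A) (ν : Measure A)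
    (π : EuclideanSpace ℝ (Fin K) → S → A → ℝ) : Prop where
  isPolicy : ∀ w, IsPolicy ν (π w)
  pos : ∀ w s a, 0 < π w s a
  differentiable : ∀ s a, Differentiable ℝ fun w => π w s a
  reward_integrable : ∀ w s, Integrable (fun a => π w s a * M.rewardSize s a) ν
  dominated : ∀ w₀, ∃ ε > 0, ∃ G : S → A → ℝ, (∀ s, Integrable (G s) ν) ∧
    ∀ w ∈ Metric.ball w₀ ε, ∀ s a,
      ‖gradient (fun w' => π w' s a) w‖ * M.rewardSize s a ≤ G s a

/-- The history `((s_0, a_0), …, (s_{t-1}, a_{t-1}), s_t)` of a state-action process. -/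
def history (s : ℕ → Ω → S) (a : ℕ → Ω → A) (t : ℕ) (ω : Ω) : (Fin t → S × A) × S :=
  (fun i => (s i ω, a i ω), s t ω)

/-- `(s_t, a_t)` is a trajectory of the MDP generated by the policy `b`, from an arbitrary initial
state distribution: given the history up to `s_t`, the action `a_t` has density `b(· | s_t)` and
then `s_{t+1}` has distribution `P(· | s_t, a_t)`. -/
structure IsTrajectory [Fintype S] [MeasurableSpace S] [MeasurableSpace A] [MeasurableSpace Ω]
    (M : MDP S A) (ν : Measure A) (b : S → A → ℝ) (Pr : Measure Ω)
    (s : ℕ → Ω → S) (a : ℕ → Ω → A) : Prop where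
  meas_state : ∀ t, Measurable (s t)
  meas_action : ∀ t, Measurable (a t)
  markov : ∀ (t : ℕ) (E : Set ((Fin t → S × A) × S)) (B : Set A) (s' : S),
    MeasurableSet E → MeasurableSet B →
    Pr {ω | history s a t ω ∈ E ∧ a t ω ∈ B ∧ s (t + 1) ω = s'} =
      ∫⁻ ω in {ω | history s a t ω ∈ E},
        (∫⁻ y in B, ENNReal.ofReal (b (s t ω) y * M.P (s t ω) y s') ∂ν) ∂Pr

/-! ### Traces along one sequence of importance ratios

`ρ t` is the importance ratio and `g t` the score at time `t`. Each trace is started at time `0`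
from the conventions `m_{-1} = λ`, `e_{-1} = 0`, `f_{-1} = 0`, `z_{-1} = 0`, `ψ_{-1} = 0`. -/

/-- `m_t = 1 + γ ρ_{t-1} (m_{t-1} - λ)`, `m_{-1} = λ`. -/
def mTrace (γ lam : ℝ) (ρ : ℕ → ℝ) : ℕ → ℝ
  | 0 => 1
  | t + 1 => 1 + γ * ρ t * (mTrace γ lam ρ t - lam)

/-- `f_t = m_t + γ λ ρ_{t-1} f_{t-1}`, `f_{-1} = 0`. -/
def fTrace (γ lam : ℝ) (ρ : ℕ → ℝ) : ℕ → ℝ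
  | 0 => mTrace γ lam ρ 0
  | t + 1 => mTrace γ lam ρ (t + 1) + γ * lam * ρ t * fTrace γ lam ρ t

/-- `e_t = m_t φ_t + γ λ ρ_{t-1} e_{t-1}`, `e_{-1} = 0`. -/
def eTrace {F : Type*} [AddCommGroup F] [Module ℝ F] (γ lam : ℝ) (ρ : ℕ → ℝ) (φ : ℕ → F) : ℕ → F
  | 0 => mTrace γ lam ρ 0 • φ 0
  | t + 1 => mTrace γ lam ρ (t + 1) • φ (t + 1) + (γ * lam * ρ t) • eTrace γ lam ρ φ t

/-- `z_t = γ ρ_{t-1} ((m_{t-1} - λ) g_{t-1} + z_{t-1})`, `z_{-1} = 0`. -/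
def zTrace {W : Type*} [AddCommGroup W] [Module ℝ W] (γ lam : ℝ) (ρ : ℕ → ℝ) (g : ℕ → W) : ℕ → W
  | 0 => 0
  | t + 1 => (γ * ρ t) • ((mTrace γ lam ρ t - lam) • g t + zTrace γ lam ρ g t)

/-- `ψ_t = f_t g_t + z_t + γ λ ρ_{t-1} ψ_{t-1}`, `ψ_{-1} = 0`. -/
def psiTrace {W : Type*} [AddCommGroup W] [Module ℝ W] (γ lam : ℝ) (ρ : ℕ → ℝ) (g : ℕ → W) : ℕ → W
  | 0 => fTrace γ lam ρ 0 • g 0 + zTrace γ lam ρ g 0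
  | t + 1 => fTrace γ lam ρ (t + 1) • g (t + 1) + zTrace γ lam ρ g (t + 1) +
      (γ * lam * ρ t) • psiTrace γ lam ρ g t

/-! ### The quantities of the actor-critic setting -/

/-- Importance ratio `ρ_t = p(a_t | s_t) / b(a_t | s_t)` of target policy `p` and behavior
policy `b`. -/
def ratio (p b : S → A → ℝ) (s : ℕ → Ω → S) (a : ℕ → Ω → A) (t : ℕ) (ω : Ω) : ℝ :=
  p (s t ω) (a t ω) / b (s t ω) (a t ω)

/-- Score `∇ log π_w(a_t | s_t)`, the gradient being taken in `w`. -/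
def score {K : ℕ} (π : EuclideanSpace ℝ (Fin K) → S → A → ℝ) (w : EuclideanSpace ℝ (Fin K))
    (s : ℕ → Ω → S) (a : ℕ → Ω → A) (t : ℕ) (ω : Ω) : EuclideanSpace ℝ (Fin K) :=
  gradient (fun w' => Real.log (π w' (s t ω) (a t ω))) w

/-- TD error `δ_t = r_{t+1} + γ θᵀφ(s_{t+1}) - θᵀφ(s_t)`. -/
def tdError [Fintype S] [MeasurableSpace A] {n : ℕ} (M : MDP S A) (γ : ℝ)
    (φ : S → EuclideanSpace ℝ (Fin n)) (θ : EuclideanSpace ℝ (Fin n))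
    (s : ℕ → Ω → S) (a : ℕ → Ω → A) (t : ℕ) (ω : Ω) : ℝ :=
  M.r (s t ω) (a t ω) (s (t + 1) ω) + γ * inner ℝ θ (φ (s (t + 1) ω)) - inner ℝ θ (φ (s t ω))

/-- The critic update direction `ρ_t δ_t e_t`. -/
def criticUpdate [Fintype S] [MeasurableSpace A] {n : ℕ} (M : MDP S A) (γ lam : ℝ)
    (φ : S → EuclideanSpace ℝ (Fin n)) (b p : S → A → ℝ) (θ : EuclideanSpace ℝ (Fin n))
    (s : ℕ → Ω → S) (a : ℕ → Ω → A) (t : ℕ) (ω : Ω) : EuclideanSpace ℝ (Fin n) :=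
  (ratio p b s a t ω * tdError M γ φ θ s a t ω) •
    eTrace γ lam (fun i => ratio p b s a i ω) (fun i => φ (s i ω)) t

/-- `θ` is an Emphatic-TD(λ) solution for the target policy `p` and data generated by `b`: the
steady-state expectation of `ρ_t δ_t e_t` vanishes. -/
def IsEmphaticTDSolution [Fintype S] [MeasurableSpace A] [MeasurableSpace Ω] {n : ℕ}
    (M : MDP S A) (γ lam : ℝ) (φ : S → EuclideanSpace ℝ (Fin n)) (b : S → A → ℝ)
    (Pr : Measure Ω) (s : ℕ → Ω → S) (a : ℕ → Ω → A)
    (p : S → A → ℝ) (θ : EuclideanSpace ℝ (Fin n)) : Prop :=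
  (∀ t, Integrable (criticUpdate M γ lam φ b p θ s a t) Pr) ∧
    Tendsto (fun t => ∫ ω, criticUpdate M γ lam φ b p θ s a t ω ∂Pr) atTop (𝓝 0)

/-- The objective `J(w) = ∑_s d(s) θ(w)ᵀφ(s)`. -/
def objective [Fintype S] {K n : ℕ} (d : S → ℝ) (φ : S → EuclideanSpace ℝ (Fin n))
    (θ : EuclideanSpace ℝ (Fin K) → EuclideanSpace ℝ (Fin n)) (w : EuclideanSpace ℝ (Fin K)) : ℝ :=
  ∑ x, d x * inner ℝ (θ w) (φ x)

/-- The actor update direction `ρ_t δ_t ψ_t` at the policy parameter `w` with critic `θ`. -/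
def actorUpdate [Fintype S] [MeasurableSpace A] {K n : ℕ} (M : MDP S A) (γ lam : ℝ)
    (φ : S → EuclideanSpace ℝ (Fin n)) (b : S → A → ℝ)
    (π : EuclideanSpace ℝ (Fin K) → S → A → ℝ) (w : EuclideanSpace ℝ (Fin K))
    (θ : EuclideanSpace ℝ (Fin n)) (s : ℕ → Ω → S) (a : ℕ → Ω → A) (t : ℕ) (ω : Ω) :
    EuclideanSpace ℝ (Fin K) :=
  (ratio (π w) b s a t ω * tdError M γ φ θ s a t ω) •
    psiTrace γ lam (fun i => ratio (π w) b s a i ω) (fun i => score π w s a i ω) t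

end EmphaticAC

end

/-! Write `P` and `R` for the transition matrix and mean reward vector of the target policy, `V = (1
- γP)⁻¹R` for its value and `F = d(1 - γP)⁻¹` for its discounted occupancy, a row vector with `F = d
+ γFP`. A fixed direction `v` in parameter space turns scores into scalars, and `D` is `P` weighted
by that score.

Importance ratios turn one step of behavior data into one application of the target matrices
(`IsTrajectory.step`). So the vectors `E[X; s_t = x]`, for `X` any of the traces, obey affine
recursions with a discounted stochastic matrix and converge to their fixed points
(`tendsto_of_discounted_recursion`). The limits are `F` for `f` and `H` for the past-dependent part
of `ψ`, where `H = γFD + γHP`; neither depends on `λ`.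

Critic: as `u` pairs to 1 with every feature, pairing `e_t` with `u` gives `f_t`. For `q = θᵀφ` the
critic equation thus yields `F·(R + γPq - q) = 0`, and `F = d + γFP` turns it into `d·q = F·R`. So
`J(w) = d·V` exactly, whatever the approximation error (`objective_eq_of_isEmphaticTDSolution`), and
no regularity of `θ` in `w` is needed.

Gradient: the derivative of `d·V` along `v` is `F·(R' + γDV)`, where `R'` is the score-weighted mean
reward, by the likelihood-ratio formula (`hasFDerivAt_value`).

Actor: the limit of `E[ρδψ]` along `v` is `F·(R' + γDq) + H·(R + γPq - q)`, since `D1 = 0`. The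
equation of `H` cancels `q`, and with `R = V - γPV` it gives `H·R = γF·DV`, hence the gradient
(`tendsto_inner_actorUpdate`). -/

namespace EmphaticAC

/-! ### One step of the trajectory and importance sampling. -/

section Markov

set_option linter.unusedSectionVars false

variable {S A Ω : Type*} [Fintype S] [MeasurableSpace S] [MeasurableSingletonClass S]
  [MeasurableSpace A] [MeasurableSpace Ω] {M : MDP S A} {ν : Measure A} {b : S → A → ℝ}
  {Pr : Measure Ω} {s : ℕ → Ω → S} {a : ℕ → Ω → A}

theorem measurable_uncurry_state {β : Type*} [MeasurableSpace β] {k : S → A → β}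
    (hk : ∀ x, Measurable (k x)) : Measurable fun q : S × A => k q.1 q.2 :=
  measurable_from_prod_countable_right hk

theorem IsTrajectory.measurable_history (hs : IsTrajectory M ν b Pr s a) (t : ℕ) :
    Measurable (history s a t) := by
  refine Measurable.prodMk (measurable_pi_lambda _ fun i => ?_) (hs.meas_state t)
  exact (hs.meas_state i).prodMk (hs.meas_action i)

/-- The joint law of the history and the next action, on the event that the next state is `x'`. -/
theorem IsTrajectory.map_restrict [SigmaFinite ν] [IsProbabilityMeasure Pr]
    (hs : IsTrajectory M ν b Pr s a) (hb : ∀ x, Measurable (b x)) (t : ℕ) (x' : S) :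
    (Pr.restrict (s (t + 1) ⁻¹' {x'})).map (fun ω => (history s a t ω, a t ω)) =
      ((Pr.map (history s a t)).prod ν).withDensity
        (fun q => ENNReal.ofReal (b q.1.2 q.2 * M.P q.1.2 q.2 x')) := by
  have hh := hs.measurable_history t
  have ha := hs.meas_action t
  have hd : Measurable fun q : ((Fin t → S × A) × S) × A =>
      ENNReal.ofReal (b q.1.2 q.2 * M.P q.1.2 q.2 x') :=
    ((measurable_uncurry_state (k := fun x y => b x y * M.P x y x')
      fun x => (hb x).mul (M.P_meas x x')).comp
      ((measurable_snd.comp measurable_fst).prodMk measurable_snd)).ennreal_ofReal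
  have : IsProbabilityMeasure (Pr.map (history s a t)) :=
    Measure.isProbabilityMeasure_map hh.aemeasurable
  -- On rectangles the claim is, after Fubini, the Markov property of the trajectory.
  refine Measure.ext_prod fun {E B} hE hB => ?_
  rw [Measure.map_apply (hh.prodMk ha) (hE.prod hB),
    Measure.restrict_apply ((hh.prodMk ha) (hE.prod hB)), withDensity_apply _ (hE.prod hB),
    ← Measure.prod_restrict, lintegral_prod _ hd.aemeasurable,
    setLIntegral_map hE hd.lintegral_prod_right' hh]
  refine Eq.trans ?_ (hs.markov t E B x' hE hB)
  congr 1
  ext ω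
  simp [and_assoc]

/-- On the event that the next state is `x'`, history and action have density `b · P` with respect
to (law of the history) × `ν`. The ratio `p / b` cancels `b`, which leaves target quantities only,
and Fubini separates the past from the action. -/
theorem IsTrajectory.step [SigmaFinite ν] [IsProbabilityMeasure Pr]
    (hs : IsTrajectory M ν b Pr s a) (hb : ∀ x, Measurable (b x)) (hb_pos : ∀ x y, 0 < b x y)
    {p : S → A → ℝ} (hp : ∀ x, Measurable (p x)) {k : S → A → S → ℝ}
    (hk : ∀ x x', Measurable fun y => k x y x')
    (hki : ∀ x x', Integrable (fun y => p x y * M.P x y x' * k x y x') ν) {t : ℕ} {X : Ω → ℝ}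
    (hXm : Measurable[MeasurableSpace.comap (history s a t) inferInstance] X)
    (hX : Integrable X Pr) (x' : S) :
    IntegrableOn (fun ω => X ω * (ratio p b s a t ω * k (s t ω) (a t ω) (s (t + 1) ω)))
        (s (t + 1) ⁻¹' {x'}) Pr ∧
      ∫ ω in s (t + 1) ⁻¹' {x'}, X ω * (ratio p b s a t ω * k (s t ω) (a t ω) (s (t + 1) ω)) ∂Pr =
        ∑ x, (∫ ω in s t ⁻¹' {x}, X ω ∂Pr) * ∫ y, p x y * M.P x y x' * k x y x' ∂ν := by
  have hh := hs.measurable_history t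
  have ha := hs.meas_action t
  -- Doob–Dynkin: `X` is a measurable function of the history.
  obtain ⟨g, hg, rfl⟩ := hXm.exists_eq_measurable_comp
  set μ := Pr.map (history s a t)
  have : IsProbabilityMeasure μ := Measure.isProbabilityMeasure_map hh.aemeasurable
  have hproj : Measurable fun q : ((Fin t → S × A) × S) × A => (q.1.2, q.2) :=
    (measurable_snd.comp measurable_fst).prodMk measurable_snd
  set G : ((Fin t → S × A) × S) × A → ℝ := fun q =>
    g q.1 * (p q.1.2 q.2 / b q.1.2 q.2 * k q.1.2 q.2 x') with hG
  have hGm : Measurable G := (hg.comp measurable_fst).mul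
    ((measurable_uncurry_state (k := fun x y => p x y / b x y * k x y x')
      fun x => ((hp x).div (hb x)).mul (hk x x')).comp hproj)
  have hd : Measurable fun q : ((Fin t → S × A) × S) × A =>
      ENNReal.ofReal (b q.1.2 q.2 * M.P q.1.2 q.2 x') :=
    ((measurable_uncurry_state (k := fun x y => b x y * M.P x y x')
      fun x => (hb x).mul (M.P_meas x x')).comp hproj).ennreal_ofReal
  have hset : MeasurableSet (s (t + 1) ⁻¹' {x'}) :=
    hs.meas_state (t + 1) (measurableSet_singleton x')
  have hcongr : Set.EqOn (fun ω => (g ∘ history s a t) ω *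
      (ratio p b s a t ω * k (s t ω) (a t ω) (s (t + 1) ω)))
      (G ∘ fun ω => (history s a t ω, a t ω)) (s (t + 1) ⁻¹' {x'}) := by
    intro ω hω
    have hω : s (t + 1) ω = x' := hω
    simp [hG, ratio, history, hω]
  have hgi : Integrable g μ := (integrable_map_measure hg.aestronglyMeasurable hh.aemeasurable).2 hX
  -- The factor in the action still depends on the current state. Splitting over that state gives a
  -- finite sum of genuine products, one factor in the history and one in the action.
  have hexp : ∀ q : ((Fin t → S × A) × S) × A,
      (ENNReal.ofReal (b q.1.2 q.2 * M.P q.1.2 q.2 x')).toReal • G q =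
      ∑ x, ({h : (Fin t → S × A) × S | h.2 = x}.indicator g q.1) *
        (p x q.2 * M.P x q.2 x' * k x q.2 x') := by
    intro q
    rw [Finset.sum_eq_single q.1.2, Set.indicator_of_mem (by rfl), ENNReal.toReal_ofReal
      (mul_nonneg (hb_pos _ _).le (M.P_nonneg _ _ _)), smul_eq_mul, hG]
    · have := (hb_pos q.1.2 q.2).ne'
      field_simp
    · intro x _ hx
      rw [Set.indicator_of_notMem, zero_mul]
      exact fun h => hx h.symm
    · simp
  have hind : ∀ x, MeasurableSet {h : (Fin t → S × A) × S | h.2 = x} := fun x =>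
    measurable_snd (measurableSet_singleton x)
  have hterm : ∀ x, Integrable (fun q : ((Fin t → S × A) × S) × A =>
      ({h : (Fin t → S × A) × S | h.2 = x}.indicator g q.1) *
        (p x q.2 * M.P x q.2 x' * k x q.2 x')) (μ.prod ν) := fun x =>
    (hgi.indicator (hind x)).mul_prod (hki x x')
  constructor
  · rw [integrableOn_congr_fun hcongr hset, IntegrableOn,
      ← integrable_map_measure hGm.aestronglyMeasurable (hh.prodMk ha).aemeasurable,
      hs.map_restrict hb, integrable_withDensity_iff_integrable_smul' hd (by simp)]
    simp_rw [hexp]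
    exact integrable_finsetSum _ fun x _ => hterm x
  · rw [setIntegral_congr_fun hset hcongr]
    simp only [Function.comp_apply]
    rw [← integral_map (f := G) (hh.prodMk ha).aemeasurable hGm.aestronglyMeasurable,
      hs.map_restrict hb, integral_withDensity_eq_integral_toReal_smul hd (by simp)]
    simp_rw [hexp]
    rw [integral_finsetSum _ fun x _ => hterm x]
    refine Finset.sum_congr rfl fun x _ => ?_
    rw [integral_prod_mul (μ := μ) (ν := ν)
      (fun h => {h : (Fin t → S × A) × S | h.2 = x}.indicator g h)
      (fun y => p x y * M.P x y x' * k x y x'), integral_indicator (hind x),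
      setIntegral_map (hind x) hg.aestronglyMeasurable hh.aemeasurable]
    rfl

theorem pairwise_disjoint_preimage_state (s : ℕ → Ω → S) (t : ℕ) :
    Pairwise (Function.onFun Disjoint fun x => s t ⁻¹' {x}) := fun x y hxy =>
  Disjoint.preimage _ (by simpa using hxy)

theorem iUnion_preimage_state (s : ℕ → Ω → S) (t : ℕ) : ⋃ x, s t ⁻¹' {x} = Set.univ := by
  ext ω; simp

theorem IsTrajectory.integral_eq_sum (hs : IsTrajectory M ν b Pr s a) (t : ℕ) {X : Ω → ℝ}
    (hX : Integrable X Pr) : ∫ ω, X ω ∂Pr = ∑ x, ∫ ω in s t ⁻¹' {x}, X ω ∂Pr := by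
  rw [← integral_iUnion_fintype (fun x => hs.meas_state t (measurableSet_singleton x))
    (pairwise_disjoint_preimage_state s t) fun x => hX.integrableOn, iUnion_preimage_state,
    Measure.restrict_univ]

theorem IsTrajectory.step_integrable [SigmaFinite ν] [IsProbabilityMeasure Pr]
    (hs : IsTrajectory M ν b Pr s a) (hb : ∀ x, Measurable (b x)) (hb_pos : ∀ x y, 0 < b x y)
    {p : S → A → ℝ} (hp : ∀ x, Measurable (p x)) {k : S → A → S → ℝ}
    (hk : ∀ x x', Measurable fun y => k x y x')
    (hki : ∀ x x', Integrable (fun y => p x y * M.P x y x' * k x y x') ν) {t : ℕ} {X : Ω → ℝ}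
    (hXm : Measurable[MeasurableSpace.comap (history s a t) inferInstance] X)
    (hX : Integrable X Pr) :
    Integrable (fun ω => X ω * (ratio p b s a t ω * k (s t ω) (a t ω) (s (t + 1) ω))) Pr := by
  rw [← integrableOn_univ, ← iUnion_preimage_state s (t + 1), integrableOn_finite_iUnion]
  exact fun x' => (hs.step hb hb_pos hp hk hki hXm hX x').1

theorem measurable_comap_history_mono (s : ℕ → Ω → S) (a : ℕ → Ω → A) (t : ℕ) :
    MeasurableSpace.comap (history s a t) inferInstance ≤
      MeasurableSpace.comap (history s a (t + 1)) inferInstance := by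
  have : history s a t = (fun h : (Fin (t + 1) → S × A) × S =>
      ((fun i : Fin t => h.1 i.castSucc), (h.1 (Fin.last t)).1)) ∘ history s a (t + 1) := by
    funext ω; simp [history]
  rw [this, ← MeasurableSpace.comap_comp]
  refine MeasurableSpace.comap_mono (Measurable.comap_le ?_)
  fun_prop

theorem measurable_comap_history_step (s : ℕ → Ω → S) (a : ℕ → Ω → A) (t : ℕ)
    {k : S → A → ℝ} (hk : ∀ x, Measurable (k x)) :
    Measurable[MeasurableSpace.comap (history s a (t + 1)) inferInstance]
      fun ω => k (s t ω) (a t ω) := by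
  have : (fun ω => k (s t ω) (a t ω)) = (fun h : (Fin (t + 1) → S × A) × S =>
      k (h.1 (Fin.last t)).1 (h.1 (Fin.last t)).2) ∘ history s a (t + 1) := by
    funext ω; simp [history]
  rw [this]
  exact ((measurable_uncurry_state hk).comp (by fun_prop)).comp (comap_measurable _)

end Markov
-- Discounted recursions and stochastic matrices.
theorem tendsto_zero_of_le_add_mul {u η : ℕ → ℝ} {c : ℝ} (hc0 : 0 ≤ c) (hc1 : c < 1)
    (hu : ∀ t, 0 ≤ u t) (hη : Tendsto η atTop (𝓝 0)) (h : ∀ t, u (t + 1) ≤ η t + c * u t) :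
    Tendsto u atTop (𝓝 0) := by
  rw [Metric.tendsto_atTop]
  intro ε hε
  -- With this threshold the level `ε / 2` reproduces itself: `ε(1 - c)/2 + c·ε/2 = ε/2`.
  have h1 : ∀ᶠ t in atTop, η t < ε * (1 - c) / 2 :=
    hη.eventually_lt_const (by have : 0 < 1 - c := by linarith
                               positivity)
  obtain ⟨N, hN⟩ := eventually_atTop.1 h1
  have h2 : ∀ k, u (N + k) ≤ c ^ k * u N + ε / 2 := by
    intro k
    induction k with
    | zero => simp; linarith
    | succ k ih =>
      have h3 := h (N + k)
      have h4 := hN (N + k) (by omega)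
      have h5 := mul_le_mul_of_nonneg_left ih hc0
      rw [pow_succ, ← add_assoc]
      nlinarith
  have h6 : Tendsto (fun k => c ^ k * u N) atTop (𝓝 0) := by
    simpa using (tendsto_pow_atTop_nhds_zero_of_lt_one hc0 hc1).mul_const (u N)
  obtain ⟨K, hK⟩ := eventually_atTop.1 (h6.eventually_lt_const (half_pos hε))
  refine ⟨N + K, fun t ht => ?_⟩
  obtain ⟨k, rfl⟩ := Nat.exists_eq_add_of_le (show N ≤ t by omega)
  rw [Real.dist_eq, sub_zero, abs_of_nonneg (hu _)]
  have := h2 k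
  have := hK k (by omega)
  linarith

section Stochastic

open Matrix

variable {S : Type*} [Fintype S]

/-- Affine iterations with a discounted stochastic matrix converge to their fixed point. -/
theorem tendsto_of_discounted_recursion {P : Matrix S S ℝ} (hP0 : ∀ x x', 0 ≤ P x x')
    (hP1 : ∀ x, ∑ x', P x x' = 1) {c : ℝ} (hc0 : 0 ≤ c) (hc1 : c < 1) {X Y : ℕ → S → ℝ}
    {X' Y' : S → ℝ} (hX : ∀ t, X (t + 1) = Y t + c • (X t ᵥ* P))
    (hY : Tendsto Y atTop (𝓝 Y')) (hX' : X' = Y' + c • (X' ᵥ* P)) :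
    Tendsto X atTop (𝓝 X') := by
  -- A stochastic matrix acting on row vectors does not increase the ℓ¹ norm, so the ℓ¹ distance to
  -- the fixed point contracts by `c`, up to the error of `Y`.
  have key : Tendsto (fun t => ∑ x, |X t x - X' x|) atTop (𝓝 0) := by
    refine tendsto_zero_of_le_add_mul (η := fun t => ∑ x, |Y t x - Y' x|) hc0 hc1
      (fun t => Finset.sum_nonneg fun x _ => abs_nonneg _) ?_ ?_
    · rw [tendsto_pi_nhds] at hY
      have := tendsto_finsetSum Finset.univ fun x _ => ((hY x).sub_const (Y' x)).abs
      simpa using this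
    · intro t
      have h1 : ∀ x', |X (t + 1) x' - X' x'| ≤
          |Y t x' - Y' x'| + c * ∑ x, |X t x - X' x| * P x x' := by
        intro x'
        have h2 : X (t + 1) x' - X' x' =
            (Y t x' - Y' x') + c * ∑ x, (X t x - X' x) * P x x' := by
          have e := congrFun hX' x'
          rw [hX t]
          simp only [Pi.add_apply, Pi.smul_apply, smul_eq_mul, vecMul, dotProduct] at e ⊢
          simp only [sub_mul, Finset.sum_sub_distrib]
          linarith
        rw [h2]
        refine (abs_add_le _ _).trans (add_le_add le_rfl ?_)
        rw [abs_mul, abs_of_nonneg hc0]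
        refine mul_le_mul_of_nonneg_left ((Finset.abs_sum_le_sum_abs _ _).trans ?_) hc0
        simp [abs_mul, abs_of_nonneg (hP0 _ _)]
      refine (Finset.sum_le_sum fun x' _ => h1 x').trans ?_
      rw [Finset.sum_add_distrib, ← Finset.mul_sum, Finset.sum_comm]
      simp [← Finset.mul_sum, hP1]
  rw [tendsto_pi_nhds]
  intro x
  rw [tendsto_iff_norm_sub_tendsto_zero]
  exact squeeze_zero (fun _ => norm_nonneg _) (fun t =>
    Finset.single_le_sum (f := fun x => |X t x - X' x|) (fun x _ => abs_nonneg _)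
      (Finset.mem_univ x)) key

theorem tendsto_vecMul {X : ℕ → S → ℝ} {X' : S → ℝ} (h : Tendsto X atTop (𝓝 X'))
    (A : Matrix S S ℝ) : Tendsto (fun t => X t ᵥ* A) atTop (𝓝 (X' ᵥ* A)) :=
  ((continuous_id.matrix_vecMul continuous_const).tendsto X').comp h

/-- Strict diagonal dominance: the off-diagonal entries of row `x` have absolute sum `c(1 - P x x)`,
less than `1 - c P x x`. -/
theorem isUnit_det_one_sub_smul [DecidableEq S] {P : Matrix S S ℝ} (hP0 : ∀ x x', 0 ≤ P x x')
    (hP1 : ∀ x, ∑ x', P x x' = 1) {c : ℝ} (hc0 : 0 ≤ c) (hc1 : c < 1) :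
    IsUnit (1 - c • P).det := by
  rw [isUnit_iff_ne_zero]
  refine det_ne_zero_of_sum_row_lt_diag fun x => ?_
  have h1 : ∑ j ∈ Finset.univ.erase x, ‖(1 - c • P) x j‖ =
      ∑ j ∈ Finset.univ.erase x, c * P x j := by
    refine Finset.sum_congr rfl fun j hj => ?_
    have : x ≠ j := (Finset.ne_of_mem_erase hj).symm
    simp [this, abs_of_nonneg (hP0 _ _), abs_of_nonneg hc0]
  have h2 := Finset.add_sum_erase Finset.univ (fun j => P x j) (Finset.mem_univ x)
  rw [hP1] at h2
  rw [h1, ← Finset.mul_sum]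
  refine lt_of_lt_of_le ?_ (le_abs_self _)
  simp only [Matrix.sub_apply, one_apply_eq, Matrix.smul_apply, smul_eq_mul]
  nlinarith

end Stochastic

/-! ### Differentiating transition means in the policy parameter. -/

section Family

variable {S A : Type*} [Fintype S] [MeasurableSpace A] {M : MDP S A} {ν : Measure A} {K : ℕ}
  {π : EuclideanSpace ℝ (Fin K) → S → A → ℝ}

theorem MDP.one_le_rewardSize (M : MDP S A) (x : S) (y : A) : 1 ≤ M.rewardSize x y :=
  le_add_of_nonneg_right <| Finset.sum_nonneg fun _ _ => mul_nonneg (M.P_nonneg _ _ _) (abs_nonneg _)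

theorem MDP.P_le_one (M : MDP S A) (x : S) (y : A) (x' : S) : M.P x y x' ≤ 1 := by
  rw [← M.P_sum x y]
  exact Finset.single_le_sum (f := M.P x y) (fun _ _ => M.P_nonneg _ _ _) (Finset.mem_univ x')

/-- A measurable function of a transition whose conditional size is controlled by that of the
rewards. -/
structure MDP.IsRewardBounded (M : MDP S A) (k : S → A → S → ℝ) : Prop where
  meas : ∀ x x', Measurable fun y => k x y x'
  bound : ∃ C, 0 ≤ C ∧ ∀ x y x', M.P x y x' * |k x y x'| ≤ C * M.rewardSize x y

theorem MDP.isRewardBounded_r (M : MDP S A) : M.IsRewardBounded M.r where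
  meas := M.r_meas
  bound := ⟨1, zero_le_one, fun x y x' => by
    have := Finset.single_le_sum (f := fun x' => M.P x y x' * |M.r x y x'|)
      (fun _ _ => mul_nonneg (M.P_nonneg _ _ _) (abs_nonneg _)) (Finset.mem_univ x')
    simp only [MDP.rewardSize] at this ⊢
    linarith⟩

/-- There are finitely many states, and the summand 1 in `rewardSize` absorbs constants. This covers
both the weight 1 and the value terms of the TD error. -/
theorem MDP.isRewardBounded_of_state (M : MDP S A) (c : S → S → ℝ) :
    M.IsRewardBounded fun x _ x' => c x x' where
  meas _ _ := measurable_const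
  bound := by
    refine ⟨∑ x, ∑ x', |c x x'|, by positivity, fun x y x' => ?_⟩
    calc M.P x y x' * |c x x'| ≤ 1 * |c x x'| :=
          mul_le_mul_of_nonneg_right (M.P_le_one x y x') (abs_nonneg _)
      _ ≤ ∑ x', |c x x'| := by
          rw [one_mul]
          exact Finset.single_le_sum (f := fun x' => |c x x'|) (fun _ _ => abs_nonneg _)
            (Finset.mem_univ x')
      _ ≤ ∑ x, ∑ x', |c x x'| :=
          Finset.single_le_sum (f := fun x => ∑ x', |c x x'|)
            (fun _ _ => Finset.sum_nonneg fun _ _ => abs_nonneg _) (Finset.mem_univ x)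
      _ ≤ _ := le_mul_of_one_le_right (by positivity) (M.one_le_rewardSize x y)

theorem MDP.IsRewardBounded.add {k l : S → A → S → ℝ} (hk : M.IsRewardBounded k)
    (hl : M.IsRewardBounded l) : M.IsRewardBounded fun x y x' => k x y x' + l x y x' where
  meas x x' := (hk.meas x x').add (hl.meas x x')
  bound := by
    obtain ⟨C, hC0, hC⟩ := hk.bound
    obtain ⟨D, hD0, hD⟩ := hl.bound
    refine ⟨C + D, by positivity, fun x y x' => ?_⟩
    have := mul_le_mul_of_nonneg_left (abs_add_le (k x y x') (l x y x')) (M.P_nonneg x y x')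
    linarith [hC x y x', hD x y x']

/-- `⟨∇ log π_w(y | x), v⟩`. -/
noncomputable def directionalScore (π : EuclideanSpace ℝ (Fin K) → S → A → ℝ)
    (w v : EuclideanSpace ℝ (Fin K)) (x : S) (y : A) : ℝ :=
  inner ℝ (gradient (fun w' => Real.log (π w' x y)) w) v

theorem inner_gradient_eq_fderiv (f : EuclideanSpace ℝ (Fin K) → ℝ)
    (w v : EuclideanSpace ℝ (Fin K)) : inner ℝ (gradient f w) v = fderiv ℝ f w v := by
  rw [gradient, InnerProductSpace.toDual_symm_apply]

theorem norm_gradient_eq (f : EuclideanSpace ℝ (Fin K) → ℝ)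
    (w : EuclideanSpace ℝ (Fin K)) : ‖gradient f w‖ = ‖fderiv ℝ f w‖ := by
  rw [gradient, LinearIsometryEquiv.norm_map]

theorem IsPolicyFamily.mul_directionalScore (hπ : IsPolicyFamily M ν π)
    (w v : EuclideanSpace ℝ (Fin K)) (x : S) (y : A) :
    π w x y * directionalScore π w v x y = fderiv ℝ (fun w' => π w' x y) w v := by
  have hpos := hπ.pos w x y
  rw [directionalScore, inner_gradient_eq_fderiv,
    ((hπ.differentiable x y w).hasFDerivAt.log hpos.ne').fderiv]
  simp [hpos.ne']

/-- A directional derivative is the pointwise limit of the difference quotients with step `1 / n`,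
each measurable in the action. -/
theorem IsPolicyFamily.measurable_fderiv_apply (hπ : IsPolicyFamily M ν π)
    (w v : EuclideanSpace ℝ (Fin K)) (x : S) :
    Measurable fun y => fderiv ℝ (fun w' => π w' x y) w v := by
  refine measurable_of_tendsto_metrizable (f := fun (n : ℕ) y =>
    (n : ℝ) • (π (w + (n : ℝ)⁻¹ • v) x y - π w x y)) (fun n => ?_) ?_
  · exact (((hπ.isPolicy _).meas x).sub ((hπ.isPolicy _).meas x)).const_smul (n : ℝ)
  · rw [tendsto_pi_nhds]
    intro y
    exact ((hπ.differentiable x y w).hasFDerivAt.lim_real v).comp tendsto_natCast_atTop_atTop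

theorem IsPolicyFamily.measurable_directionalScore (hπ : IsPolicyFamily M ν π)
    (w v : EuclideanSpace ℝ (Fin K)) (x : S) : Measurable (directionalScore π w v x) := by
  have : directionalScore π w v x =
      fun y => fderiv ℝ (fun w' => π w' x y) w v / π w x y := by
    funext y
    rw [← hπ.mul_directionalScore, mul_div_cancel_left₀ _ (hπ.pos w x y).ne']
  rw [this]
  exact (hπ.measurable_fderiv_apply w v x).div ((hπ.isPolicy w).meas x)

theorem IsPolicyFamily.measurable_fderiv (hπ : IsPolicyFamily M ν π)
    (w : EuclideanSpace ℝ (Fin K)) (x : S) :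
    StronglyMeasurable fun y => fderiv ℝ (fun w' => π w' x y) w := by
  have : (fun y => fderiv ℝ (fun w' => π w' x y) w) = fun y => ∑ i,
      fderiv ℝ (fun w' => π w' x y) w (EuclideanSpace.basisFun (Fin K) ℝ i) •
        innerSL ℝ (EuclideanSpace.basisFun (Fin K) ℝ i) := by
    funext y
    ext v
    conv_lhs => rw [← (EuclideanSpace.basisFun (Fin K) ℝ).sum_repr' v]
    simp [mul_comm]
  rw [this]
  exact Finset.stronglyMeasurable_fun_sum _ fun i _ =>
    (hπ.measurable_fderiv_apply w _ x).stronglyMeasurable.smul_const _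

/-- The matrix of conditional expectations `E[k(s_t, a_t, s_{t+1}); s_{t+1} = x' | s_t = x]` under
the policy `p`. -/
noncomputable def transitionMean (M : MDP S A) (ν : Measure A) (p : S → A → ℝ)
    (k : S → A → S → ℝ) : Matrix S S ℝ :=
  fun x x' => ∫ y, p x y * M.P x y x' * k x y x' ∂ν

theorem IsPolicyFamily.integrable (hπ : IsPolicyFamily M ν π) {k : S → A → S → ℝ}
    (hk : M.IsRewardBounded k) (w : EuclideanSpace ℝ (Fin K)) (x x' : S) :
    Integrable (fun y => π w x y * M.P x y x' * k x y x') ν := by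
  obtain ⟨C, hC0, hC⟩ := hk.bound
  refine ((hπ.reward_integrable w x).const_mul C).mono'
    ((((hπ.isPolicy w).meas x).mul (M.P_meas x x')).mul (hk.meas x x')).aestronglyMeasurable
    (Eventually.of_forall fun y => ?_)
  have := mul_le_mul_of_nonneg_left (hC x y x') (hπ.pos w x y).le
  rw [norm_mul, norm_mul, Real.norm_of_nonneg (hπ.pos w x y).le,
    Real.norm_of_nonneg (M.P_nonneg x y x'), Real.norm_eq_abs]
  linarith

/-- Differentiation under the integral sign: `P |k| ≤ C · rewardSize`, so the domination hypothesis
bounds the derivative of the integrand near `w` by `C * G`. -/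
theorem IsPolicyFamily.hasFDerivAt_transitionMean_aux (hπ : IsPolicyFamily M ν π)
    {k : S → A → S → ℝ} (hk : M.IsRewardBounded k) (w : EuclideanSpace ℝ (Fin K)) (x x' : S) :
    Integrable (fun y => (M.P x y x' * k x y x') • fderiv ℝ (fun w' => π w' x y) w) ν ∧
    HasFDerivAt (fun w => transitionMean M ν (π w) k x x')
      (∫ y, (M.P x y x' * k x y x') • fderiv ℝ (fun w' => π w' x y) w ∂ν) w := by
  obtain ⟨C, hC0, hC⟩ := hk.bound
  obtain ⟨ε, hε, G, hG, hdom⟩ := hπ.dominated w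
  have hmeas : AEStronglyMeasurable
      (fun y => (M.P x y x' * k x y x') • fderiv ℝ (fun w' => π w' x y) w) ν :=
    (((M.P_meas x x').mul (hk.meas x x')).stronglyMeasurable.smul
      (hπ.measurable_fderiv w x)).aestronglyMeasurable
  have hbound : ∀ y, ∀ w' ∈ Metric.ball w ε,
      ‖(M.P x y x' * k x y x') • fderiv ℝ (fun w' => π w' x y) w'‖ ≤ C * G x y := by
    intro y w' hw'
    have h1 := hdom w' hw' x y
    rw [norm_gradient_eq] at h1
    rw [norm_smul, norm_mul, Real.norm_of_nonneg (M.P_nonneg x y x'), Real.norm_eq_abs]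
    have h2 := mul_le_mul_of_nonneg_right (hC x y x')
      (norm_nonneg (fderiv ℝ (fun w' => π w' x y) w'))
    have h3 := mul_le_mul_of_nonneg_left h1 hC0
    linarith
  refine ⟨((hG x).const_mul C).mono' hmeas (Eventually.of_forall fun y =>
    hbound y w (Metric.mem_ball_self hε)), ?_⟩
  refine hasFDerivAt_integral_of_dominated_of_fderiv_le (bound := fun y => C * G x y)
    (F' := fun w y => (M.P x y x' * k x y x') • fderiv ℝ (fun w' => π w' x y) w)
    (Metric.ball_mem_nhds w hε)
    (Eventually.of_forall fun w' => (hπ.integrable hk w' x x').aestronglyMeasurable)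
    (hπ.integrable hk w x x') hmeas (Eventually.of_forall hbound) ((hG x).const_mul C)
    (Eventually.of_forall fun y w' _ => ?_)
  have := (hπ.differentiable x y w').hasFDerivAt.mul_const (M.P x y x' * k x y x')
  simpa only [mul_assoc] using this

/-- Since `π ∇log π = ∇π`, this integrand is the integrable derivative of the previous lemma
evaluated at `v`; no separate moment of the score is required. -/
theorem IsPolicyFamily.score_integrable (hπ : IsPolicyFamily M ν π) {k : S → A → S → ℝ}
    (hk : M.IsRewardBounded k) (w v : EuclideanSpace ℝ (Fin K)) (x x' : S) :
    Integrable (fun y => π w x y * M.P x y x' * (directionalScore π w v x y * k x y x')) ν := by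
  refine ((hπ.hasFDerivAt_transitionMean_aux hk w x x').1.apply_continuousLinearMap v).congr
    (Eventually.of_forall fun y => ?_)
  simp only [_root_.smul_apply, smul_eq_mul, ← hπ.mul_directionalScore]
  ring

/-- The derivative in `w` of the transition means is given by the likelihood-ratio formula. -/
theorem IsPolicyFamily.hasFDerivAt_transitionMean (hπ : IsPolicyFamily M ν π)
    {k : S → A → S → ℝ} (hk : M.IsRewardBounded k) (w : EuclideanSpace ℝ (Fin K)) (x x' : S) :
    ∃ L : EuclideanSpace ℝ (Fin K) →L[ℝ] ℝ,
      HasFDerivAt (fun w => transitionMean M ν (π w) k x x') L w ∧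
      ∀ v, L v =
        transitionMean M ν (π w) (fun x y x' => directionalScore π w v x y * k x y x') x x' := by
  obtain ⟨h1, h2⟩ := hπ.hasFDerivAt_transitionMean_aux hk w x x'
  refine ⟨_, h2, fun v => ?_⟩
  rw [ContinuousLinearMap.integral_apply h1]
  refine integral_congr_ae (Eventually.of_forall fun y => ?_)
  simp only [_root_.smul_apply, smul_eq_mul, ← hπ.mul_directionalScore]
  ring

end Family

/-! ### Pathwise algebra of the traces. -/

section Traces

/-- The part `z_t + γ λ ρ_{t-1} ψ_{t-1}` of `ψ_t` that depends on the past only. -/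
noncomputable def psiTail (γ lam : ℝ) (ρ g : ℕ → ℝ) : ℕ → ℝ
  | 0 => 0
  | t + 1 => zTrace γ lam ρ g (t + 1) +
      γ * lam * ρ t * (fTrace γ lam ρ t * g t + psiTail γ lam ρ g t)

/-- The one-step formula needs functionals of the history up to `s_t`, whereas `ψ_t` also involves
`a_t` through the score. Here that dependence is isolated in one term. -/
theorem psiTrace_eq (γ lam : ℝ) (ρ g : ℕ → ℝ) (t : ℕ) :
    psiTrace γ lam ρ g t = fTrace γ lam ρ t * g t + psiTail γ lam ρ g t := by
  induction t with
  | zero => simp [psiTrace, psiTail, zTrace]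
  | succ t ih => simp only [psiTrace, psiTail, ih, smul_eq_mul]; ring

theorem inner_zTrace {K : ℕ} (γ lam : ℝ) (ρ : ℕ → ℝ) (g : ℕ → EuclideanSpace ℝ (Fin K))
    (v : EuclideanSpace ℝ (Fin K)) (t : ℕ) :
    inner ℝ (zTrace γ lam ρ g t) v = zTrace γ lam ρ (fun i => inner ℝ (g i) v) t := by
  induction t with
  | zero => simp [zTrace]
  | succ t ih => simp [zTrace, inner_add_left, inner_smul_left, ih, mul_add]

theorem inner_psiTrace {K : ℕ} (γ lam : ℝ) (ρ : ℕ → ℝ) (g : ℕ → EuclideanSpace ℝ (Fin K))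
    (v : EuclideanSpace ℝ (Fin K)) (t : ℕ) :
    inner ℝ (psiTrace γ lam ρ g t) v = psiTrace γ lam ρ (fun i => inner ℝ (g i) v) t := by
  induction t with
  | zero => simp [psiTrace, inner_add_left, inner_smul_left, inner_zTrace]
  | succ t ih => simp [psiTrace, inner_add_left, inner_smul_left, inner_zTrace, ih]

/-- Pairing with `u` erases the features, and the recursion of `e` becomes that of `f`. This is
where having constants in the span of the features enters. -/
theorem inner_eTrace_of_inner_eq_one {n : ℕ} (γ lam : ℝ) (ρ : ℕ → ℝ)
    {φ : ℕ → EuclideanSpace ℝ (Fin n)} {u : EuclideanSpace ℝ (Fin n)}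
    (hu : ∀ i, inner ℝ u (φ i) = 1) (t : ℕ) :
    inner ℝ u (eTrace γ lam ρ φ t) = fTrace γ lam ρ t := by
  induction t with
  | zero => simp [eTrace, fTrace, inner_smul_right, hu]
  | succ t ih => simp [eTrace, fTrace, inner_add_right, inner_smul_right, hu, ih]

end Traces

/-! ### Partial expectations of the traces: recursions and limits. -/

section OffPolicy

open Matrix

set_option linter.unusedSectionVars false

variable {S A Ω : Type*} [Fintype S] [MeasurableSpace S] [MeasurableSingletonClass S]
  [MeasurableSpace A] [MeasurableSpace Ω] {M : MDP S A} {ν : Measure A} {b p : S → A → ℝ}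
  {g : S → A → ℝ} {Pr : Measure Ω} {s : ℕ → Ω → S} {a : ℕ → Ω → A} {t : ℕ} {X Y : Ω → ℝ}

/-- `X` is an integrable function of the history up to `s_t`. -/
structure IsHistoryIntegrable (Pr : Measure Ω) (s : ℕ → Ω → S) (a : ℕ → Ω → A) (t : ℕ)
    (X : Ω → ℝ) : Prop where
  meas : Measurable[MeasurableSpace.comap (history s a t) inferInstance] X
  integrable : Integrable X Pr

/-- The vector of partial expectations `E[X; s_t = x]`. -/
noncomputable def stateMean (Pr : Measure Ω) (s : ℕ → Ω → S) (t : ℕ) (X : Ω → ℝ) : S → ℝ :=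
  fun x => ∫ ω in s t ⁻¹' {x}, X ω ∂Pr

theorem IsHistoryIntegrable.const [IsProbabilityMeasure Pr] (c : ℝ) :
    IsHistoryIntegrable Pr s a t fun _ => c :=
  ⟨measurable_const, integrable_const c⟩

theorem IsHistoryIntegrable.add (hX : IsHistoryIntegrable Pr s a t X)
    (hY : IsHistoryIntegrable Pr s a t Y) : IsHistoryIntegrable Pr s a t fun ω => X ω + Y ω :=
  ⟨hX.meas.add hY.meas, hX.integrable.add hY.integrable⟩

theorem IsHistoryIntegrable.const_mul (hX : IsHistoryIntegrable Pr s a t X) (c : ℝ) :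
    IsHistoryIntegrable Pr s a t fun ω => c * X ω :=
  ⟨hX.meas.const_mul c, hX.integrable.const_mul c⟩

theorem stateMean_add (hX : IsHistoryIntegrable Pr s a t X)
    (hY : IsHistoryIntegrable Pr s a t Y) :
    stateMean Pr s t (fun ω => X ω + Y ω) = stateMean Pr s t X + stateMean Pr s t Y := by
  funext x
  exact integral_add hX.integrable.integrableOn hY.integrable.integrableOn

theorem stateMean_const_mul (c : ℝ) :
    stateMean Pr s t (fun ω => c * X ω) = c • stateMean Pr s t X := by
  funext x
  exact integral_const_mul c _

/-- Data generated by `b`, a target policy `p`, and a scalar score `g`. -/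
structure IsOffPolicy (M : MDP S A) (ν : Measure A) (b : S → A → ℝ) (Pr : Measure Ω)
    (s : ℕ → Ω → S) (a : ℕ → Ω → A) (p g : S → A → ℝ) : Prop where
  traj : IsTrajectory M ν b Pr s a
  behavior_meas : ∀ x, Measurable (b x)
  behavior_pos : ∀ x y, 0 < b x y
  target_meas : ∀ x, Measurable (p x)
  target_nonneg : ∀ x y, 0 ≤ p x y
  target_integral : ∀ x, ∫ y, p x y ∂ν = 1
  score_meas : ∀ x, Measurable (g x)
  target_integrable : ∀ x x', Integrable (fun y => p x y * M.P x y x' * 1) ν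
  score_integrable : ∀ x x', Integrable (fun y => p x y * M.P x y x' * g x y) ν

/-- The transition matrix of the policy `p`. -/
noncomputable abbrev transitionMatrix (M : MDP S A) (ν : Measure A) (p : S → A → ℝ) :
    Matrix S S ℝ :=
  transitionMean M ν p fun _ _ _ => 1

/-- The transition matrix of the policy `p`, weighted by the score. -/
noncomputable abbrev scoreMatrix (M : MDP S A) (ν : Measure A) (p g : S → A → ℝ) :
    Matrix S S ℝ :=
  transitionMean M ν p fun x y _ => g x y

theorem IsOffPolicy.transitionMatrix_nonneg (h : IsOffPolicy M ν b Pr s a p g) (x x' : S) :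
    0 ≤ transitionMatrix M ν p x x' :=
  integral_nonneg fun y => mul_nonneg (mul_nonneg (h.target_nonneg x y) (M.P_nonneg x y x'))
    zero_le_one

theorem IsOffPolicy.transitionMatrix_sum (h : IsOffPolicy M ν b Pr s a p g) (x : S) :
    ∑ x', transitionMatrix M ν p x x' = 1 := by
  simp only [transitionMean]
  rw [← integral_finsetSum _ fun x' _ => h.target_integrable x x']
  refine Eq.trans ?_ (h.target_integral x)
  simp [← Finset.mul_sum, M.P_sum]

variable [SigmaFinite ν] [IsProbabilityMeasure Pr]

/-- One transition: the conditional expectation of a weighted history functional. -/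
theorem IsOffPolicy.stateMean_step (h : IsOffPolicy M ν b Pr s a p g)
    (hX : IsHistoryIntegrable Pr s a t X) {k : S → A → ℝ} (hk : ∀ x, Measurable (k x))
    (hki : ∀ x x', Integrable (fun y => p x y * M.P x y x' * k x y) ν) :
    IsHistoryIntegrable Pr s a (t + 1)
        (fun ω => X ω * (ratio p b s a t ω * k (s t ω) (a t ω))) ∧
      stateMean Pr s (t + 1) (fun ω => X ω * (ratio p b s a t ω * k (s t ω) (a t ω))) =
        stateMean Pr s t X ᵥ* transitionMean M ν p fun x y _ => k x y := by
  have hi := fun x' => h.traj.step h.behavior_meas h.behavior_pos h.target_meas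
    (k := fun x y _ => k x y) (fun x _ => hk x) hki hX.meas hX.integrable x'
  refine ⟨⟨?_, ?_⟩, ?_⟩
  · refine (hX.meas.mono (measurable_comap_history_mono s a t) le_rfl).mul ?_
    exact measurable_comap_history_step s a t (k := fun x y => p x y / b x y * k x y)
      fun x => ((h.target_meas x).div (h.behavior_meas x)).mul (hk x)
  · exact h.traj.step_integrable h.behavior_meas h.behavior_pos h.target_meas
      (k := fun x y _ => k x y) (fun x _ => hk x) hki hX.meas hX.integrable
  · funext x'
    exact (hi x').2

theorem IsOffPolicy.stateMean_step_one (h : IsOffPolicy M ν b Pr s a p g)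
    (hX : IsHistoryIntegrable Pr s a t X) :
    IsHistoryIntegrable Pr s a (t + 1) (fun ω => X ω * ratio p b s a t ω) ∧
      stateMean Pr s (t + 1) (fun ω => X ω * ratio p b s a t ω) =
        stateMean Pr s t X ᵥ* transitionMatrix M ν p := by
  simpa using h.stateMean_step hX (k := fun _ _ => 1) (fun _ => measurable_const)
    h.target_integrable

theorem IsOffPolicy.stateMean_step_score (h : IsOffPolicy M ν b Pr s a p g)
    (hX : IsHistoryIntegrable Pr s a t X) :
    IsHistoryIntegrable Pr s a (t + 1)
        (fun ω => X ω * (ratio p b s a t ω * g (s t ω) (a t ω))) ∧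
      stateMean Pr s (t + 1) (fun ω => X ω * (ratio p b s a t ω * g (s t ω) (a t ω))) =
        stateMean Pr s t X ᵥ* scoreMatrix M ν p g :=
  h.stateMean_step hX h.score_meas h.score_integrable

/-- Expectation of a weighted transition functional times a history functional. -/
theorem IsOffPolicy.integral_step (h : IsOffPolicy M ν b Pr s a p g)
    (hX : IsHistoryIntegrable Pr s a t X) {k : S → A → S → ℝ}
    (hk : ∀ x x', Measurable fun y => k x y x')
    (hki : ∀ x x', Integrable (fun y => p x y * M.P x y x' * k x y x') ν) :
    Integrable (fun ω => X ω * (ratio p b s a t ω * k (s t ω) (a t ω) (s (t + 1) ω))) Pr ∧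
      ∫ ω, X ω * (ratio p b s a t ω * k (s t ω) (a t ω) (s (t + 1) ω)) ∂Pr =
        stateMean Pr s t X ⬝ᵥ (transitionMean M ν p k *ᵥ 1) := by
  have hi := h.traj.step_integrable h.behavior_meas h.behavior_pos h.target_meas hk hki hX.meas
    hX.integrable
  refine ⟨hi, ?_⟩
  rw [h.traj.integral_eq_sum (t + 1) hi, dotProduct_mulVec, dotProduct_one]
  exact Finset.sum_congr rfl fun x' _ => (h.traj.step h.behavior_meas h.behavior_pos
    h.target_meas hk hki hX.meas hX.integrable x').2

variable {γ lam : ℝ}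

theorem IsOffPolicy.mTrace_step (h : IsOffPolicy M ν b Pr s a p g)
    (hm : IsHistoryIntegrable Pr s a t fun ω => mTrace γ lam (fun i => ratio p b s a i ω) t) :
    IsHistoryIntegrable Pr s a (t + 1)
        (fun ω => mTrace γ lam (fun i => ratio p b s a i ω) (t + 1)) ∧
      stateMean Pr s (t + 1) (fun ω => mTrace γ lam (fun i => ratio p b s a i ω) (t + 1)) =
        (stateMean Pr s (t + 1) (fun _ => 1) +
          (-γ * lam) • (stateMean Pr s t (fun _ => 1) ᵥ* transitionMatrix M ν p)) +
        γ • (stateMean Pr s t (fun ω => mTrace γ lam (fun i => ratio p b s a i ω) t) ᵥ*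
          transitionMatrix M ν p) := by
  obtain ⟨h1, h1'⟩ := h.stateMean_step_one hm
  obtain ⟨h2, h2'⟩ := h.stateMean_step_one (IsHistoryIntegrable.const (s := s) (a := a) (t := t) (1 : ℝ))
  have h3 : IsHistoryIntegrable Pr s a (t + 1) fun _ => 1 := .const 1
  -- The factor `1 *` exhibits the constant 1 as the history functional to be propagated by one
  -- step.
  have e : (fun ω => mTrace γ lam (fun i => ratio p b s a i ω) (t + 1)) = fun ω =>
      (1 + (-γ * lam) * (1 * ratio p b s a t ω)) +
        γ * (mTrace γ lam (fun i => ratio p b s a i ω) t * ratio p b s a t ω) := by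
    funext ω
    simp only [mTrace]
    ring
  rw [e]
  refine ⟨(h3.add (h2.const_mul _)).add (h1.const_mul _), ?_⟩
  rw [stateMean_add (h3.add (h2.const_mul _)) (h1.const_mul _), stateMean_add h3 (h2.const_mul _),
    stateMean_const_mul (-γ * lam), stateMean_const_mul γ, h1', h2']

theorem IsOffPolicy.mTrace_integrable (h : IsOffPolicy M ν b Pr s a p g) (t : ℕ) :
    IsHistoryIntegrable Pr s a t fun ω => mTrace γ lam (fun i => ratio p b s a i ω) t := by
  induction t with
  | zero => exact .const 1
  | succ t ih => exact (h.mTrace_step ih).1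

theorem IsOffPolicy.fTrace_step (h : IsOffPolicy M ν b Pr s a p g)
    (hf : IsHistoryIntegrable Pr s a t fun ω => fTrace γ lam (fun i => ratio p b s a i ω) t) :
    IsHistoryIntegrable Pr s a (t + 1)
        (fun ω => fTrace γ lam (fun i => ratio p b s a i ω) (t + 1)) ∧
      stateMean Pr s (t + 1) (fun ω => fTrace γ lam (fun i => ratio p b s a i ω) (t + 1)) =
        stateMean Pr s (t + 1) (fun ω => mTrace γ lam (fun i => ratio p b s a i ω) (t + 1)) +
        (γ * lam) • (stateMean Pr s t (fun ω => fTrace γ lam (fun i => ratio p b s a i ω) t) ᵥ*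
          transitionMatrix M ν p) := by
  obtain ⟨h1, h1'⟩ := h.stateMean_step_one hf
  have h2 := h.mTrace_integrable (γ := γ) (lam := lam) (t + 1)
  have e : (fun ω => fTrace γ lam (fun i => ratio p b s a i ω) (t + 1)) = fun ω =>
      mTrace γ lam (fun i => ratio p b s a i ω) (t + 1) +
        (γ * lam) * (fTrace γ lam (fun i => ratio p b s a i ω) t * ratio p b s a t ω) := by
    funext ω
    simp only [fTrace]
    ring
  rw [e]
  refine ⟨h2.add (h1.const_mul _), ?_⟩
  rw [stateMean_add h2 (h1.const_mul _), stateMean_const_mul, h1']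

theorem IsOffPolicy.fTrace_integrable (h : IsOffPolicy M ν b Pr s a p g) (t : ℕ) :
    IsHistoryIntegrable Pr s a t fun ω => fTrace γ lam (fun i => ratio p b s a i ω) t := by
  induction t with
  | zero => exact .const 1
  | succ t ih => exact (h.fTrace_step ih).1

theorem IsOffPolicy.zTrace_step (h : IsOffPolicy M ν b Pr s a p g)
    (hz : IsHistoryIntegrable Pr s a t fun ω =>
      zTrace γ lam (fun i => ratio p b s a i ω) (fun i => g (s i ω) (a i ω)) t) :
    IsHistoryIntegrable Pr s a (t + 1) (fun ω =>
        zTrace γ lam (fun i => ratio p b s a i ω) (fun i => g (s i ω) (a i ω)) (t + 1)) ∧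
      stateMean Pr s (t + 1) (fun ω =>
        zTrace γ lam (fun i => ratio p b s a i ω) (fun i => g (s i ω) (a i ω)) (t + 1)) =
        γ • ((stateMean Pr s t (fun ω => mTrace γ lam (fun i => ratio p b s a i ω) t) +
          (-lam) • stateMean Pr s t (fun _ => 1)) ᵥ* scoreMatrix M ν p g) +
        γ • (stateMean Pr s t (fun ω =>
          zTrace γ lam (fun i => ratio p b s a i ω) (fun i => g (s i ω) (a i ω)) t) ᵥ*
          transitionMatrix M ν p) := by
  have hm := h.mTrace_integrable (γ := γ) (lam := lam) t
  have h0 : IsHistoryIntegrable Pr s a t fun _ => 1 := .const 1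
  obtain ⟨h1, h1'⟩ := h.stateMean_step_one hz
  obtain ⟨h2, h2'⟩ := h.stateMean_step_score (hm.add (h0.const_mul (-lam)))
  have e : (fun ω =>
      zTrace γ lam (fun i => ratio p b s a i ω) (fun i => g (s i ω) (a i ω)) (t + 1)) = fun ω =>
      γ * ((mTrace γ lam (fun i => ratio p b s a i ω) t + (-lam) * 1) *
        (ratio p b s a t ω * g (s t ω) (a t ω))) +
      γ * (zTrace γ lam (fun i => ratio p b s a i ω) (fun i => g (s i ω) (a i ω)) t *
        ratio p b s a t ω) := by
    funext ω
    simp only [zTrace, smul_eq_mul]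
    ring
  rw [e]
  refine ⟨(h2.const_mul _).add (h1.const_mul _), ?_⟩
  rw [stateMean_add (h2.const_mul _) (h1.const_mul _), stateMean_const_mul, stateMean_const_mul,
    h1', h2', stateMean_add hm (h0.const_mul _), stateMean_const_mul]

theorem IsOffPolicy.zTrace_integrable (h : IsOffPolicy M ν b Pr s a p g) (t : ℕ) :
    IsHistoryIntegrable Pr s a t fun ω =>
      zTrace γ lam (fun i => ratio p b s a i ω) (fun i => g (s i ω) (a i ω)) t := by
  induction t with
  | zero => exact .const 0
  | succ t ih => exact (h.zTrace_step ih).1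

theorem IsOffPolicy.psiTail_step (h : IsOffPolicy M ν b Pr s a p g)
    (hz : IsHistoryIntegrable Pr s a t fun ω =>
      psiTail γ lam (fun i => ratio p b s a i ω) (fun i => g (s i ω) (a i ω)) t) :
    IsHistoryIntegrable Pr s a (t + 1) (fun ω =>
        psiTail γ lam (fun i => ratio p b s a i ω) (fun i => g (s i ω) (a i ω)) (t + 1)) ∧
      stateMean Pr s (t + 1) (fun ω =>
        psiTail γ lam (fun i => ratio p b s a i ω) (fun i => g (s i ω) (a i ω)) (t + 1)) =
        (stateMean Pr s (t + 1) (fun ω =>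
          zTrace γ lam (fun i => ratio p b s a i ω) (fun i => g (s i ω) (a i ω)) (t + 1)) +
        (γ * lam) • (stateMean Pr s t (fun ω => fTrace γ lam (fun i => ratio p b s a i ω) t) ᵥ*
          scoreMatrix M ν p g)) +
        (γ * lam) • (stateMean Pr s t (fun ω =>
          psiTail γ lam (fun i => ratio p b s a i ω) (fun i => g (s i ω) (a i ω)) t) ᵥ*
          transitionMatrix M ν p) := by
  have h0 := h.zTrace_integrable (γ := γ) (lam := lam) (t + 1)
  obtain ⟨h1, h1'⟩ := h.stateMean_step_one hz
  obtain ⟨h2, h2'⟩ := h.stateMean_step_score (h.fTrace_integrable (γ := γ) (lam := lam) t)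
  have e : (fun ω =>
      psiTail γ lam (fun i => ratio p b s a i ω) (fun i => g (s i ω) (a i ω)) (t + 1)) = fun ω =>
      (zTrace γ lam (fun i => ratio p b s a i ω) (fun i => g (s i ω) (a i ω)) (t + 1) +
      (γ * lam) * (fTrace γ lam (fun i => ratio p b s a i ω) t *
        (ratio p b s a t ω * g (s t ω) (a t ω)))) +
      (γ * lam) * (psiTail γ lam (fun i => ratio p b s a i ω) (fun i => g (s i ω) (a i ω)) t *
        ratio p b s a t ω) := by
    funext ω
    simp only [psiTail]
    ring
  rw [e]
  refine ⟨(h0.add (h2.const_mul _)).add (h1.const_mul _), ?_⟩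
  rw [stateMean_add (h0.add (h2.const_mul _)) (h1.const_mul _), stateMean_add h0 (h2.const_mul _),
    stateMean_const_mul, stateMean_const_mul, h1', h2']

theorem IsOffPolicy.psiTail_integrable (h : IsOffPolicy M ν b Pr s a p g) (t : ℕ) :
    IsHistoryIntegrable Pr s a t fun ω =>
      psiTail γ lam (fun i => ratio p b s a i ω) (fun i => g (s i ω) (a i ω)) t := by
  induction t with
  | zero => exact .const 0
  | succ t ih => exact (h.psiTail_step ih).1

/-! ### Limits of the expected traces -/

variable {d F H : S → ℝ}

/-- The limit solves `m = d - γλ dP + γ mP`: the `dP` terms cancel and `γFP = F - d`. -/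
theorem IsOffPolicy.tendsto_mTrace (h : IsOffPolicy M ν b Pr s a p g)
    (hγ0 : 0 ≤ γ) (hγ1 : γ < 1)
    (hd : Tendsto (fun t => stateMean Pr s t fun _ => 1) atTop (𝓝 d))
    (hF : F = d + γ • (F ᵥ* transitionMatrix M ν p)) :
    Tendsto (fun t => stateMean Pr s t fun ω => mTrace γ lam (fun i => ratio p b s a i ω) t)
      atTop (𝓝 (lam • d + (1 - lam) • F)) := by
  refine tendsto_of_discounted_recursion h.transitionMatrix_nonneg h.transitionMatrix_sum hγ0 hγ1
    (fun t => (h.mTrace_step (h.mTrace_integrable t)).2)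
    ((hd.comp (tendsto_add_atTop_nat 1)).add
      ((tendsto_vecMul hd (transitionMatrix M ν p)).const_smul (-γ * lam))) ?_
  funext x
  have e := congrFun hF x
  simp only [add_vecMul, smul_vecMul, Pi.add_apply, Pi.smul_apply, smul_eq_mul] at e ⊢
  linear_combination (1 - lam) * e

/-- The `λ`-dependence cancels: `λd + (1 - λ)F + γλ FP = F`, because `γFP = F - d`. -/
theorem IsOffPolicy.tendsto_fTrace (h : IsOffPolicy M ν b Pr s a p g)
    (hγ0 : 0 ≤ γ) (hγ1 : γ < 1) (hlam0 : 0 ≤ lam) (hlam1 : lam ≤ 1)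
    (hd : Tendsto (fun t => stateMean Pr s t fun _ => 1) atTop (𝓝 d))
    (hF : F = d + γ • (F ᵥ* transitionMatrix M ν p)) :
    Tendsto (fun t => stateMean Pr s t fun ω => fTrace γ lam (fun i => ratio p b s a i ω) t)
      atTop (𝓝 F) := by
  refine tendsto_of_discounted_recursion h.transitionMatrix_nonneg h.transitionMatrix_sum
    (mul_nonneg hγ0 hlam0) (by nlinarith) (fun t => (h.fTrace_step (h.fTrace_integrable t)).2)
    ((h.tendsto_mTrace (lam := lam) hγ0 hγ1 hd hF).comp (tendsto_add_atTop_nat 1)) ?_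
  funext x
  have e := congrFun hF x
  simp only [Pi.add_apply, Pi.smul_apply, smul_eq_mul] at e ⊢
  linear_combination lam * e

/-- Subtracting `λ` from `m` leaves `(1 - λ)F` in the limit, so the equation for `z` is `1 - λ`
times the equation for `H`. -/
theorem IsOffPolicy.tendsto_zTrace (h : IsOffPolicy M ν b Pr s a p g)
    (hγ0 : 0 ≤ γ) (hγ1 : γ < 1)
    (hd : Tendsto (fun t => stateMean Pr s t fun _ => 1) atTop (𝓝 d))
    (hF : F = d + γ • (F ᵥ* transitionMatrix M ν p))
    (hH : H = γ • (F ᵥ* scoreMatrix M ν p g) + γ • (H ᵥ* transitionMatrix M ν p)) :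
    Tendsto (fun t => stateMean Pr s t fun ω =>
      zTrace γ lam (fun i => ratio p b s a i ω) (fun i => g (s i ω) (a i ω)) t)
      atTop (𝓝 ((1 - lam) • H)) := by
  refine tendsto_of_discounted_recursion h.transitionMatrix_nonneg h.transitionMatrix_sum hγ0 hγ1
    (fun t => (h.zTrace_step (h.zTrace_integrable t)).2)
    ((tendsto_vecMul ((h.tendsto_mTrace (lam := lam) hγ0 hγ1 hd hF).add (hd.const_smul (-lam)))
      (scoreMatrix M ν p g)).const_smul γ) ?_
  funext x
  have e := congrFun hH x
  simp only [add_vecMul, smul_vecMul, Pi.add_apply, Pi.smul_apply, smul_eq_mul] at e ⊢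
  linear_combination (1 - lam) * e

/-- The `z` part contributes `(1 - λ)H` and the trace part `λ(γFD + γHP) = λH`; together they give
`H` for every `λ`. -/
theorem IsOffPolicy.tendsto_psiTail (h : IsOffPolicy M ν b Pr s a p g)
    (hγ0 : 0 ≤ γ) (hγ1 : γ < 1) (hlam0 : 0 ≤ lam) (hlam1 : lam ≤ 1)
    (hd : Tendsto (fun t => stateMean Pr s t fun _ => 1) atTop (𝓝 d))
    (hF : F = d + γ • (F ᵥ* transitionMatrix M ν p))
    (hH : H = γ • (F ᵥ* scoreMatrix M ν p g) + γ • (H ᵥ* transitionMatrix M ν p)) :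
    Tendsto (fun t => stateMean Pr s t fun ω =>
      psiTail γ lam (fun i => ratio p b s a i ω) (fun i => g (s i ω) (a i ω)) t)
      atTop (𝓝 H) := by
  refine tendsto_of_discounted_recursion h.transitionMatrix_nonneg h.transitionMatrix_sum
    (mul_nonneg hγ0 hlam0) (by nlinarith) (fun t => (h.psiTail_step (h.psiTail_integrable t)).2)
    (((h.tendsto_zTrace (lam := lam) hγ0 hγ1 hd hF hH).comp (tendsto_add_atTop_nat 1)).add
      ((tendsto_vecMul (h.tendsto_fTrace hγ0 hγ1 hlam0 hlam1 hd hF)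
        (scoreMatrix M ν p g)).const_smul (γ * lam))) ?_
  funext x
  have e := congrFun hH x
  simp only [Pi.add_apply, Pi.smul_apply, smul_eq_mul] at e ⊢
  linear_combination lam * e

end OffPolicy

/-! ### Derivative of a discounted value. -/

section Resolvent

open Matrix

/-- In the product rule the term with the derivative of `f` carries the factor `h w = 0`, so
continuity of `f` is enough. -/
theorem hasFDerivAt_mul_of_continuousAt_of_eq_zero {E : Type*} [NormedAddCommGroup E]
    [NormedSpace ℝ E] {f h : E → ℝ} {L : E →L[ℝ] ℝ} {w : E} (hf : ContinuousAt f w)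
    (hh : HasFDerivAt h L w) (h0 : h w = 0) :
    HasFDerivAt (fun w' => f w' * h w') (f w • L) w := by
  rw [hasFDerivAt_iff_isLittleO]
  have h1 := hasFDerivAt_iff_isLittleO.1 hh
  have h2 : (fun w' => h w') =O[𝓝 w] fun w' => w' - w := by
    simpa [h0] using hh.isBigO_sub
  have h3 : (fun w' => f w' - f w) =o[𝓝 w] fun _ => (1 : ℝ) :=
    (Asymptotics.isLittleO_one_iff ℝ).2 (by simpa using hf.tendsto.sub_const (f w))
  have h4 := h3.mul_isBigO h2.norm_right
  have h5 := h1.const_mul_left (f w)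
  simp only [one_mul] at h4
  refine (h4.of_norm_right.add h5).congr_left fun w' => ?_
  simp only [h0, _root_.smul_apply, smul_eq_mul]
  ring

variable {S : Type*} [Fintype S] [DecidableEq S]

theorem vecMul_resolvent {P : Matrix S S ℝ} {c : ℝ} (hu : IsUnit (1 - c • P).det) (d : S → ℝ) :
    d ᵥ* (1 - c • P)⁻¹ = d + c • ((d ᵥ* (1 - c • P)⁻¹) ᵥ* P) := by
  have h : (d ᵥ* (1 - c • P)⁻¹) ᵥ* (1 - c • P) = d := by
    rw [vecMul_vecMul, nonsing_inv_mul _ hu, vecMul_one]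
  rw [vecMul_sub, vecMul_one, vecMul_smul] at h
  exact sub_eq_iff_eq_add.1 h

theorem resolvent_mulVec {P : Matrix S S ℝ} {c : ℝ} (hu : IsUnit (1 - c • P).det) (r : S → ℝ) :
    (1 - c • P)⁻¹ *ᵥ r = r + c • (P *ᵥ ((1 - c • P)⁻¹ *ᵥ r)) := by
  have h : (1 - c • P) *ᵥ ((1 - c • P)⁻¹ *ᵥ r) = r := by
    rw [mulVec_mulVec, mul_nonsing_inv _ hu, one_mulVec]
  rw [sub_mulVec, one_mulVec, smul_mulVec] at h
  exact sub_eq_iff_eq_add.1 h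

omit [DecidableEq S] in
theorem dotProduct_of_discounted_fixedPoint {P : Matrix S S ℝ} {c : ℝ} {X Y : S → ℝ}
    (hX : X = Y + c • (X ᵥ* P)) (q : S → ℝ) : X ⬝ᵥ q = Y ⬝ᵥ q + c * (X ⬝ᵥ (P *ᵥ q)) := by
  conv_lhs => rw [hX]
  rw [add_dotProduct, smul_dotProduct, ← dotProduct_mulVec, smul_eq_mul]

omit [DecidableEq S] in
theorem mulVec_one_apply (P : Matrix S S ℝ) (x : S) : (P *ᵥ 1) x = ∑ x', P x x' := by
  simp [mulVec, dotProduct]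

omit [DecidableEq S] in
theorem tendsto_dotProduct {X : ℕ → S → ℝ} {X' : S → ℝ} (h : Tendsto X atTop (𝓝 X'))
    (q : S → ℝ) : Tendsto (fun t => X t ⬝ᵥ q) atTop (𝓝 (X' ⬝ᵥ q)) :=
  ((continuous_id.dotProduct continuous_const).tendsto X').comp h

/-- The derivative of a discounted value `dᵀ (1 - c P)⁻¹ R` depending on a parameter. -/
theorem hasFDerivAt_discounted_value {E : Type*} [NormedAddCommGroup E] [NormedSpace ℝ E]
    {P : E → Matrix S S ℝ} {R : E → S → ℝ} {LP : S → S → E →L[ℝ] ℝ} {LR : S → E →L[ℝ] ℝ} {w : E}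
    {c : ℝ} (hP : ∀ x x', HasFDerivAt (fun w => P w x x') (LP x x') w)
    (hR : ∀ x, HasFDerivAt (fun w => R w x) (LR x) w)
    (hu : ∀ w, IsUnit (1 - c • P w).det) (d : S → ℝ) :
    HasFDerivAt (fun w => (d ᵥ* (1 - c • P w)⁻¹) ⬝ᵥ R w)
      (∑ x, (d ᵥ* (1 - c • P w)⁻¹) x •
        (LR x + c • ∑ x', ((1 - c • P w)⁻¹ *ᵥ R w) x' • LP x x')) w := by
  set v := (1 - c • P w)⁻¹ *ᵥ R w with hv
  have hPc : ContinuousAt P w := by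
    refine continuousAt_pi.2 fun x => continuousAt_pi.2 fun x' => (hP x x').continuousAt
  have hFc : ContinuousAt (fun w => d ᵥ* (1 - c • P w)⁻¹) w := by
    have h1 : ContinuousAt (fun w => (1 - c • P w)⁻¹) w := by
      refine ContinuousAt.comp (f := fun w => 1 - c • P w) (g := fun A => A⁻¹)
        (continuousAt_matrix_inv _ ?_) (continuousAt_const.sub (hPc.const_smul c))
      rw [Ring.inverse_eq_inv']
      exact continuousAt_inv₀ (hu w).ne_zero
    exact (continuous_const.matrix_vecMul continuous_id).continuousAt.comp h1
  have hB : ∀ x, HasFDerivAt (fun w' => R w' x + c * ∑ x', v x' * P w' x x' - v x)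
      (LR x + c • ∑ x', v x' • LP x x') w := fun x =>
    ((hR x).add ((HasFDerivAt.fun_sum fun x' _ => (hP x x').const_mul (v x')).const_mul c)).sub_const _
  have hB0 : ∀ x, R w x + c * ∑ x', v x' * P w x x' - v x = 0 := by
    intro x
    have := congrFun (resolvent_mulVec (hu w) (R w)) x
    rw [← hv] at this
    simp only [Pi.add_apply, Pi.smul_apply, smul_eq_mul, mulVec, dotProduct] at this
    rw [this, sub_eq_zero]
    simp only [mul_comm]
  -- With `v` frozen at `w`, this identity is exact in `w'`. Its Bellman residual vanishes at `w' =
  -- w`, so the resolvent need not be differentiated, only shown continuous.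
  have hJ : ∀ w', (d ᵥ* (1 - c • P w')⁻¹) ⬝ᵥ R w' = (d ⬝ᵥ v) +
      ∑ x, (d ᵥ* (1 - c • P w')⁻¹) x * (R w' x + c * ∑ x', v x' * P w' x x' - v x) := by
    intro w'
    have h1 := dotProduct_of_discounted_fixedPoint (vecMul_resolvent (hu w') d) v
    have h2 : ∑ x, (d ᵥ* (1 - c • P w')⁻¹) x * (R w' x + c * ∑ x', v x' * P w' x x' - v x) =
        (d ᵥ* (1 - c • P w')⁻¹) ⬝ᵥ (R w' + c • (P w' *ᵥ v) - v) := by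
      refine Finset.sum_congr rfl fun x _ => ?_
      simp [mulVec, dotProduct, mul_comm]
    rw [h2, dotProduct_sub, dotProduct_add, dotProduct_smul, smul_eq_mul]
    linarith
  simp_rw [hJ]
  exact (HasFDerivAt.fun_sum fun x _ => hasFDerivAt_mul_of_continuousAt_of_eq_zero
    ((continuousAt_pi.1 hFc) x) (hB x) (hB0 x)).const_add _

end Resolvent

/-! ### The critic's objective, its gradient, and the actor's limit. -/

section ActorCritic

set_option linter.unusedSectionVars false

open Matrix

variable {S A Ω : Type*} [Fintype S] [MeasurableSpace S] [MeasurableSingletonClass S]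
  [MeasurableSpace A] [MeasurableSpace Ω] {M : MDP S A} {ν : Measure A} {K n : ℕ}
  {γ lam : ℝ} {b : S → A → ℝ} {π : EuclideanSpace ℝ (Fin K) → S → A → ℝ}
  {Pr : Measure Ω} {s : ℕ → Ω → S} {a : ℕ → Ω → A}

/-- The TD error of the transition `(x, y, x')` for the value function `q`. -/
def tdWeight (M : MDP S A) (γ : ℝ) (q : S → ℝ) (x : S) (y : A) (x' : S) : ℝ :=
  M.r x y x' + (γ * q x' - q x)

theorem isRewardBounded_tdWeight (M : MDP S A) (γ : ℝ) (q : S → ℝ) :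
    M.IsRewardBounded (tdWeight M γ q) :=
  M.isRewardBounded_r.add (M.isRewardBounded_of_state fun x x' => γ * q x' - q x)

theorem tdError_eq (φ : S → EuclideanSpace ℝ (Fin n)) (θ : EuclideanSpace ℝ (Fin n)) (t : ℕ)
    (ω : Ω) : tdError M γ φ θ s a t ω =
      tdWeight M γ (fun x => inner ℝ θ (φ x)) (s t ω) (a t ω) (s (t + 1) ω) :=
  add_sub_assoc _ _ _

/-- The values depend on the states only and leave the integral over actions. It is applied with `l
= 1` for the plain TD error and with `l` the score. -/
theorem transitionMean_tdWeight {p : S → A → ℝ} {l : S → A → ℝ}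
    (h1 : ∀ x x', Integrable (fun y => p x y * M.P x y x' * (l x y * M.r x y x')) ν)
    (h2 : ∀ x x', Integrable (fun y => p x y * M.P x y x' * l x y) ν) (q : S → ℝ) :
    transitionMean M ν p (fun x y x' => l x y * tdWeight M γ q x y x') *ᵥ 1 =
      transitionMean M ν p (fun x y x' => l x y * M.r x y x') *ᵥ 1 +
      γ • (transitionMean M ν p (fun x y _ => l x y) *ᵥ q) -
      q * (transitionMean M ν p (fun x y _ => l x y) *ᵥ 1) := by
  have h3 : ∀ x x', transitionMean M ν p (fun x y x' => l x y * tdWeight M γ q x y x') x x' =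
      transitionMean M ν p (fun x y x' => l x y * M.r x y x') x x' +
      (γ * q x' - q x) * transitionMean M ν p (fun x y _ => l x y) x x' := by
    intro x x'
    simp only [transitionMean]
    rw [← integral_const_mul, ← integral_add (h1 x x') ((h2 x x').const_mul _)]
    refine integral_congr_ae (Eventually.of_forall fun y => ?_)
    simp only [tdWeight]
    ring
  funext x
  simp only [mulVec, dotProduct, h3, Pi.one_apply, mul_one, Pi.add_apply, Pi.sub_apply,
    Pi.smul_apply, Pi.mul_apply, smul_eq_mul, Finset.mul_sum]
  rw [← Finset.sum_add_distrib, ← Finset.sum_sub_distrib]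
  refine Finset.sum_congr rfl fun x' _ => ?_
  ring

theorem IsPolicyFamily.isOffPolicy (hπ : IsPolicyFamily M ν π) (hb : IsPolicy ν b)
    (hb_pos : ∀ x y, 0 < b x y) (hs : IsTrajectory M ν b Pr s a)
    (w v : EuclideanSpace ℝ (Fin K)) :
    IsOffPolicy M ν b Pr s a (π w) (directionalScore π w v) where
  traj := hs
  behavior_meas := hb.meas
  behavior_pos := hb_pos
  target_meas := (hπ.isPolicy w).meas
  target_nonneg := (hπ.isPolicy w).nonneg
  target_integral := (hπ.isPolicy w).integral_eq_one
  score_meas := hπ.measurable_directionalScore w v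
  target_integrable := hπ.integrable (M.isRewardBounded_of_state fun _ _ => 1) w
  score_integrable x x' := by
    simpa using hπ.score_integrable (M.isRewardBounded_of_state fun _ _ => 1) w v x x'

variable [SigmaFinite ν] [IsProbabilityMeasure Pr] {d : S → ℝ}

theorem tendsto_stateMean_one (hd : ∀ x, Tendsto (fun t => Pr.real {ω | s t ω = x}) atTop (𝓝 (d x))) :
    Tendsto (fun t => stateMean Pr s t fun _ => 1) atTop (𝓝 d) := by
  rw [tendsto_pi_nhds]
  intro x
  refine (hd x).congr fun t => ?_
  simp only [stateMean, setIntegral_const, smul_eq_mul, mul_one]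
  rfl

theorem transitionMean_td_eq {g p : S → A → ℝ} (h : IsOffPolicy M ν b Pr s a p g)
    (hr : ∀ x x', Integrable (fun y => p x y * M.P x y x' * M.r x y x') ν) (q : S → ℝ) :
    transitionMean M ν p (tdWeight M γ q) *ᵥ 1 =
      transitionMean M ν p M.r *ᵥ 1 + γ • (transitionMatrix M ν p *ᵥ q) - q := by
  have h1 := transitionMean_tdWeight (M := M) (ν := ν) (γ := γ) (p := p) (l := fun _ _ => 1)
    (by simpa using hr) h.target_integrable q
  simp only [one_mul] at h1
  refine h1.trans ?_
  have h2 : transitionMatrix M ν p *ᵥ 1 = 1 := by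
    funext x
    rw [mulVec_one_apply]
    exact h.transitionMatrix_sum x
  rw [h2, mul_one]

/-- An Emphatic-TD solution has the same mean value as the target policy. -/
theorem objective_eq_of_isEmphaticTDSolution [DecidableEq S] (hγ0 : 0 ≤ γ) (hγ1 : γ < 1)
    (hlam0 : 0 ≤ lam) (hlam1 : lam ≤ 1) {p g : S → A → ℝ} (h : IsOffPolicy M ν b Pr s a p g)
    (hr : ∀ x x', Integrable (fun y => p x y * M.P x y x' * M.r x y x') ν)
    (hd : Tendsto (fun t => stateMean Pr s t fun _ => 1) atTop (𝓝 d))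
    {φ : S → EuclideanSpace ℝ (Fin n)} (hφ : ∃ u : EuclideanSpace ℝ (Fin n), ∀ x, inner ℝ u (φ x) = 1)
    {θ : EuclideanSpace ℝ (Fin n)} (hθ : IsEmphaticTDSolution M γ lam φ b Pr s a p θ) :
    ∑ x, d x * inner ℝ θ (φ x) =
      (d ᵥ* (1 - γ • transitionMatrix M ν p)⁻¹) ⬝ᵥ (transitionMean M ν p M.r *ᵥ 1) := by
  obtain ⟨u, hu⟩ := hφ
  have hdet := isUnit_det_one_sub_smul h.transitionMatrix_nonneg h.transitionMatrix_sum hγ0 hγ1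
  have hF := vecMul_resolvent hdet d
  set F := d ᵥ* (1 - γ • transitionMatrix M ν p)⁻¹
  set q : S → ℝ := fun x => inner ℝ θ (φ x) with hq
  have hint : ∀ x x', Integrable (fun y => p x y * M.P x y x' * tdWeight M γ q x y x') ν := by
    intro x x'
    refine ((hr x x').add ((h.target_integrable x x').const_mul (γ * q x' - q x))).congr
      (Eventually.of_forall fun y => ?_)
    simp only [Pi.add_apply, tdWeight]
    ring
  -- Only the component of the critic equation along `u` is used; there `e_t` becomes `f_t`, whose
  -- limit is `F`.
  have h1 : ∀ t, inner ℝ u (∫ ω, criticUpdate M γ lam φ b p θ s a t ω ∂Pr) =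
      stateMean Pr s t (fun ω => fTrace γ lam (fun i => ratio p b s a i ω) t) ⬝ᵥ
        (transitionMean M ν p (tdWeight M γ q) *ᵥ 1) := by
    intro t
    rw [← integral_inner (hθ.1 t), ← (h.integral_step (h.fTrace_integrable t)
      (isRewardBounded_tdWeight M γ q).meas hint).2]
    refine integral_congr_ae (Eventually.of_forall fun ω => ?_)
    simp only [criticUpdate, inner_smul_right, tdError_eq,
      inner_eTrace_of_inner_eq_one γ lam _ (fun i => hu (s i ω))]
    rw [mul_comm]
  have h2 : Tendsto (fun t => inner ℝ u (∫ ω, criticUpdate M γ lam φ b p θ s a t ω ∂Pr)) atTop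
      (𝓝 0) := by
    simpa using hθ.2.inner (𝕜 := ℝ) (tendsto_const_nhds (x := u)) |>.congr fun t => real_inner_comm _ _
  have h3 : Tendsto (fun t => inner ℝ u (∫ ω, criticUpdate M γ lam φ b p θ s a t ω ∂Pr)) atTop
      (𝓝 (F ⬝ᵥ (transitionMean M ν p (tdWeight M γ q) *ᵥ 1))) := by
    simp_rw [h1]
    exact tendsto_dotProduct (h.tendsto_fTrace hγ0 hγ1 hlam0 hlam1 hd hF) _
  have h4 := tendsto_nhds_unique h3 h2
  rw [transitionMean_td_eq h hr, dotProduct_sub, dotProduct_add, dotProduct_smul, smul_eq_mul] at h4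
  have h5 := dotProduct_of_discounted_fixedPoint hF q
  change d ⬝ᵥ q = _
  linarith

/-- The row sums of `P_w` are identically 1, so their derivative vanishes. Hence the baseline
`q(s_t)` in the TD error does not contribute to the score-weighted term. -/
theorem scoreMatrix_mulVec_one (hπ : IsPolicyFamily M ν π)
    (h1 : ∀ w x, ∑ x', transitionMatrix M ν (π w) x x' = 1)
    (w v : EuclideanSpace ℝ (Fin K)) :
    scoreMatrix M ν (π w) (directionalScore π w v) *ᵥ 1 = 0 := by
  funext x
  rw [mulVec_one_apply]
  choose L hL hLv using fun x' =>
    hπ.hasFDerivAt_transitionMean (M.isRewardBounded_of_state fun _ _ => 1) w x x'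
  have h2 := HasFDerivAt.fun_sum (u := Finset.univ) fun x' _ => hL x'
  have h3 : HasFDerivAt (fun w => ∑ x', transitionMatrix M ν (π w) x x')
      (0 : EuclideanSpace ℝ (Fin K) →L[ℝ] ℝ) w := by
    simp_rw [h1]
    exact hasFDerivAt_const _ _
  have h4 := congrArg (fun L => L v) (h2.unique h3)
  simp only [_root_.sum_apply, hLv, mul_one, _root_.zero_apply] at h4
  exact h4

theorem hasFDerivAt_value [DecidableEq S] (hγ0 : 0 ≤ γ) (hγ1 : γ < 1)
    (hπ : IsPolicyFamily M ν π) (h0 : ∀ w x x', 0 ≤ transitionMatrix M ν (π w) x x')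
    (h1 : ∀ w x, ∑ x', transitionMatrix M ν (π w) x x' = 1)
    (d : S → ℝ) (w : EuclideanSpace ℝ (Fin K)) :
    ∃ L : EuclideanSpace ℝ (Fin K) →L[ℝ] ℝ,
      HasFDerivAt (fun w => (d ᵥ* (1 - γ • transitionMatrix M ν (π w))⁻¹) ⬝ᵥ
        (transitionMean M ν (π w) M.r *ᵥ 1)) L w ∧
      ∀ v, L v = (d ᵥ* (1 - γ • transitionMatrix M ν (π w))⁻¹) ⬝ᵥ
        (transitionMean M ν (π w) (fun x y x' => directionalScore π w v x y * M.r x y x') *ᵥ 1 +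
          γ • (scoreMatrix M ν (π w) (directionalScore π w v) *ᵥ
            ((1 - γ • transitionMatrix M ν (π w))⁻¹ *ᵥ (transitionMean M ν (π w) M.r *ᵥ 1)))) := by
  choose LP hLP hLPv using fun x x' =>
    hπ.hasFDerivAt_transitionMean (M.isRewardBounded_of_state fun _ _ => 1) w x x'
  choose LR hLR hLRv using fun x x' => hπ.hasFDerivAt_transitionMean M.isRewardBounded_r w x x'
  have hR : ∀ x, HasFDerivAt (fun w => (transitionMean M ν (π w) M.r *ᵥ 1) x)
      (∑ x', LR x x') w := by
    intro x
    simp_rw [mulVec_one_apply]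
    exact HasFDerivAt.fun_sum fun x' _ => hLR x x'
  refine ⟨_, hasFDerivAt_discounted_value hLP hR
    (fun w => isUnit_det_one_sub_smul (h0 w) (h1 w) hγ0 hγ1) d, fun v => ?_⟩
  simp only [_root_.sum_apply, _root_.smul_apply, _root_.add_apply, hLPv, hLRv,
    smul_eq_mul, mul_one]
  refine Finset.sum_congr rfl fun x _ => ?_
  congr 1
  simp only [Pi.add_apply, Pi.smul_apply, smul_eq_mul, mulVec_one_apply]
  congr 2
  exact Finset.sum_congr rfl fun x' _ => mul_comm _ _

/-- Each component of the expected actor update converges to the corresponding derivative. -/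
theorem tendsto_inner_actorUpdate [DecidableEq S] (hγ0 : 0 ≤ γ) (hγ1 : γ < 1)
    (hlam0 : 0 ≤ lam) (hlam1 : lam ≤ 1) (hb : IsPolicy ν b) (hb_pos : ∀ x y, 0 < b x y)
    (hπ : IsPolicyFamily M ν π) (hs : IsTrajectory M ν b Pr s a)
    (hd : Tendsto (fun t => stateMean Pr s t fun _ => 1) atTop (𝓝 d))
    (φ : S → EuclideanSpace ℝ (Fin n)) (θ : EuclideanSpace ℝ (Fin n))
    (w v : EuclideanSpace ℝ (Fin K)) :
    (∀ t, Integrable (fun ω => inner ℝ (actorUpdate M γ lam φ b π w θ s a t ω) v) Pr) ∧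
    Tendsto (fun t => ∫ ω, inner ℝ (actorUpdate M γ lam φ b π w θ s a t ω) v ∂Pr) atTop
      (𝓝 ((d ᵥ* (1 - γ • transitionMatrix M ν (π w))⁻¹) ⬝ᵥ
        (transitionMean M ν (π w) (fun x y x' => directionalScore π w v x y * M.r x y x') *ᵥ 1 +
          γ • (scoreMatrix M ν (π w) (directionalScore π w v) *ᵥ
            ((1 - γ • transitionMatrix M ν (π w))⁻¹ *ᵥ
              (transitionMean M ν (π w) M.r *ᵥ 1)))))) := by
  have hall := fun w => hπ.isOffPolicy hb hb_pos hs w v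
  have h := hall w
  have hdet := isUnit_det_one_sub_smul h.transitionMatrix_nonneg h.transitionMatrix_sum hγ0 hγ1
  have hF := vecMul_resolvent hdet d
  have hval := resolvent_mulVec hdet (transitionMean M ν (π w) M.r *ᵥ 1)
  set P := transitionMatrix M ν (π w)
  set D := scoreMatrix M ν (π w) (directionalScore π w v)
  set F := d ᵥ* (1 - γ • P)⁻¹
  set V := (1 - γ • P)⁻¹ *ᵥ (transitionMean M ν (π w) M.r *ᵥ 1)
  have hH := vecMul_resolvent hdet (γ • (F ᵥ* D))
  -- `H` is the solution of `H = γFD + γHP`, the limit of the past-dependent part of `ψ`.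
  set H := (γ • (F ᵥ* D)) ᵥ* (1 - γ • P)⁻¹
  set q : S → ℝ := fun x => inner ℝ θ (φ x) with hq
  have htd := isRewardBounded_tdWeight M γ q
  have hsc : ∀ x x', Measurable fun y => directionalScore π w v x y * tdWeight M γ q x y x' :=
    fun x x' => (hπ.measurable_directionalScore w v x).mul (htd.meas x x')
  have i1 := fun t => h.integral_step (h.fTrace_integrable (γ := γ) (lam := lam) t) hsc
    (hπ.score_integrable htd w v)
  have i2 := fun t => h.integral_step (h.psiTail_integrable (γ := γ) (lam := lam) t) htd.meas
    (hπ.integrable htd w)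
  have hsplit : ∀ t, (fun ω => inner ℝ (actorUpdate M γ lam φ b π w θ s a t ω) v) = fun ω =>
      fTrace γ lam (fun i => ratio (π w) b s a i ω) t * (ratio (π w) b s a t ω *
        (directionalScore π w v (s t ω) (a t ω) *
          tdWeight M γ q (s t ω) (a t ω) (s (t + 1) ω))) +
      psiTail γ lam (fun i => ratio (π w) b s a i ω)
        (fun i => directionalScore π w v (s i ω) (a i ω)) t *
        (ratio (π w) b s a t ω * tdWeight M γ q (s t ω) (a t ω) (s (t + 1) ω)) := by
    intro t
    funext ω
    simp only [actorUpdate, real_inner_smul_left, inner_psiTrace, tdError_eq, psiTrace_eq]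
    simp only [score, directionalScore, hq]
    ring
  refine ⟨fun t => ?_, ?_⟩
  · rw [hsplit t]
    exact (i1 t).1.add (i2 t).1
  · have e : ∀ t, ∫ ω, inner ℝ (actorUpdate M γ lam φ b π w θ s a t ω) v ∂Pr = _ := fun t => by
      rw [hsplit t, integral_add (i1 t).1 (i2 t).1, (i1 t).2, (i2 t).2]
    simp_rw [e]
    have hlim := (tendsto_dotProduct (h.tendsto_fTrace hγ0 hγ1 hlam0 hlam1 hd hF)
      (transitionMean M ν (π w)
        (fun x y x' => directionalScore π w v x y * tdWeight M γ q x y x') *ᵥ 1)).add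
      (tendsto_dotProduct (h.tendsto_psiTail hγ0 hγ1 hlam0 hlam1 hd hF hH)
        (transitionMean M ν (π w) (tdWeight M γ q) *ᵥ 1))
    convert hlim using 2
    rw [transitionMean_tdWeight (hπ.score_integrable M.isRewardBounded_r w v) h.score_integrable,
      transitionMean_td_eq h (hπ.integrable M.isRewardBounded_r w),
      scoreMatrix_mulVec_one hπ (fun w => (hall w).transitionMatrix_sum) w v]
    -- `c1` cancels `q` for an arbitrary critic `θ`; `c2` and `c3` (the Bellman equation paired with
    -- `H`) give `H·R = γF·DV`.
    have c1 := dotProduct_of_discounted_fixedPoint hH q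
    have c2 := dotProduct_of_discounted_fixedPoint hH V
    have c3 := congrArg (H ⬝ᵥ ·) hval
    simp only [dotProduct_add, dotProduct_sub, dotProduct_smul, smul_dotProduct,
      ← dotProduct_mulVec, smul_eq_mul, mul_zero, dotProduct_zero] at c1 c2 c3 ⊢
    linarith

end ActorCritic

end EmphaticAC

theorem theorem4 {S A Ω : Type*} [Fintype S] [MeasurableSpace S] [MeasurableSingletonClass S]
    [MeasurableSpace A] [MeasurableSpace Ω] {K n : ℕ}
    (M : EmphaticAC.MDP S A) (ν : Measure A) [SigmaFinite ν]
    -- discount factor and bootstrapping parameter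
    (γ lam : ℝ) (hγ0 : 0 ≤ γ) (hγ1 : γ < 1) (hlam0 : 0 ≤ lam) (hlam1 : lam ≤ 1)
    -- behavior policy and parametrized target policy
    (b : S → A → ℝ) (hb : EmphaticAC.IsPolicy ν b) (hb_pos : ∀ x y, 0 < b x y)
    (π : EuclideanSpace ℝ (Fin K) → S → A → ℝ) (hπ : EmphaticAC.IsPolicyFamily M ν π)
    -- data generated by the behavior policy, with limiting (hence stationary) distribution `d`
    (Pr : Measure Ω) [IsProbabilityMeasure Pr] (s : ℕ → Ω → S) (a : ℕ → Ω → A)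
    (hs : EmphaticAC.IsTrajectory M ν b Pr s a)
    (d : S → ℝ) (hd : ∀ x, Tendsto (fun t => Pr.real {ω | s t ω = x}) atTop (𝓝 (d x)))
    -- features, with the constant function in their span (a unit feature, or tabular features)
    (φ : S → EuclideanSpace ℝ (Fin n))
    (hφ : ∃ u : EuclideanSpace ℝ (Fin n), ∀ x, inner ℝ u (φ x) = 1)
    -- the critic solution for each target policy
    (θ : EuclideanSpace ℝ (Fin K) → EuclideanSpace ℝ (Fin n))
    (hθ : ∀ w, EmphaticAC.IsEmphaticTDSolution M γ lam φ b Pr s a (π w) (θ w))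
    (w : EuclideanSpace ℝ (Fin K)) :
    DifferentiableAt ℝ (EmphaticAC.objective d φ θ) w ∧
      (∀ t, Integrable (EmphaticAC.actorUpdate M γ lam φ b π w (θ w) s a t) Pr) ∧
      Tendsto (fun t => ∫ ω, EmphaticAC.actorUpdate M γ lam φ b π w (θ w) s a t ω ∂Pr) atTop
        (𝓝 (gradient (EmphaticAC.objective d φ θ) w)) := by
  classical
  have hd' := EmphaticAC.tendsto_stateMean_one hd
  have hoff := fun w => hπ.isOffPolicy hb hb_pos hs w 0
  have hJ : EmphaticAC.objective d φ θ = fun w =>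
      Matrix.vecMul d (1 - γ • EmphaticAC.transitionMatrix M ν (π w))⁻¹ ⬝ᵥ
        Matrix.mulVec (EmphaticAC.transitionMean M ν (π w) M.r) 1 := by
    funext w
    exact EmphaticAC.objective_eq_of_isEmphaticTDSolution hγ0 hγ1 hlam0 hlam1 (hoff w)
      (hπ.integrable M.isRewardBounded_r w) hd' hφ (hθ w)
  obtain ⟨L, hL, hLv⟩ := EmphaticAC.hasFDerivAt_value hγ0 hγ1 hπ
    (fun w => (hoff w).transitionMatrix_nonneg) (fun w => (hoff w).transitionMatrix_sum) d w
  rw [← hJ] at hL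
  have hact := fun v => EmphaticAC.tendsto_inner_actorUpdate hγ0 hγ1 hlam0 hlam1 hb hb_pos hπ hs
    hd' φ (θ w) w v
  simp_rw [← hLv] at hact
  -- Integrability and limits are known for each component; an orthonormal basis reassembles the
  -- vector statements.
  let B := EuclideanSpace.basisFun (Fin K) ℝ
  have hint : ∀ t, Integrable (EmphaticAC.actorUpdate M γ lam φ b π w (θ w) s a t) Pr := by
    intro t
    refine (integrable_finsetSum Finset.univ fun i _ =>
      ((hact (B i)).1 t).smul_const (B i)).congr (Eventually.of_forall fun ω => ?_)
    simp_rw [real_inner_comm (B _)]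
    exact B.sum_repr' _
  refine ⟨hL.differentiableAt, hint, ?_⟩
  have hlim := tendsto_finsetSum Finset.univ fun i _ => (hact (B i)).2.smul_const (B i)
  have hgrad : ∑ i, L (B i) • B i = gradient (EmphaticAC.objective d φ θ) w := by
    rw [← B.sum_repr' (gradient (EmphaticAC.objective d φ θ) w)]
    simp_rw [real_inner_comm _ (B _), EmphaticAC.inner_gradient_eq_fderiv, hL.fderiv]
  rw [hgrad] at hlim
  refine hlim.congr fun t => ?_
  rw [← B.sum_repr' (∫ ω, EmphaticAC.actorUpdate M γ lam φ b π w (θ w) s a t ω ∂Pr)]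
  simp_rw [← integral_inner (hint t), real_inner_comm (B _)]
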